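/- Let $p$ be a prime and let $\mathcal F$ be a saturated fusion system over a finite $p$-group $S$. For $Q\le S$ let $N_{\mathcal F}(Q)$ be the normaliser subsystem over $N_S(Q)$, whose morphisms $U\to V$ are those $\varphi\in\mathrm{Hom}_{\mathcal F}(U,V)$ that extend to some $\tilde\varphi\in\mathrm{Hom}_{\mathcal F}(UQ,VQ)$ with $\tilde\varphi(Q)=Q$. A subgroup $Q$ is normal in $\mathcal F$ if $N_{\mathcal F}(Q)=\mathcal F$, and $O_p(\mathcal F)$ is the largest subgroup of $S$ that is normal in $\mathcal F$. A subgroup $Q\le S$ is - fully $\mathcal F$-normalised if $|N_S(Q)|\ge|N_S(P)|$ for all $\mathcal F$-conjugates $P$ of $Q$; - $\mathcal F$-centric if $C_S(P)=Z(P)$ for all $\mathcal F$-conjugates $P$ of $Q$; - $\mathcal F$-radical if $O_p(\mathrm{Out}_{\mathcal F}(Q))=1$; - $\mathcal F$-essential if it is fully $\mathcal F$-normalised and $\mathcal F$-centric and $H=\mathrm{Out}_{\mathcal F}(Q)$ has a strongly $p$-embedded subgroup, that is, a proper subgroup $M<H$ with $p\mid |M|$ and $p\nmid |M\cap xMx^{-1}|$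 for all $x\in H\setminus M$; - weakly centric-radical in $\mathcal F$ if $O_p(N_{\mathcal F}(Q))=Q$. Write $\mathcal F^e$ for the set of $\mathcal F$-essential subgroups, and $\mathcal F^{fcr}$ for the set of subgroups that are fully $\mathcal F$-normalised, $\mathcal F$-centric and $\mathcal F$-radical. A chain $\sigma\colon Q_0<Q_1<\dots<Q_n$ of subgroups of $S$, of length $n\ge 0$, is weakly centric-radical in $\mathcal F$ if $N_{\mathcal F}(Q_0)=\mathcal F$, $O_p(\mathcal F)<Q_1$ (when $n\ge1$), and $Q_i$ is weakly centric-radical in $\mathcal F_{i-1}$ for $1\le i\le n$, where $\mathcal F_0=\mathcal F$ and $\mathcal F_i=N_{\mathcal F_{i-1}}(Q_i)$. The weakly local rank $\mathrm{rank}_w(\mathcal F)$ is the length of a longest weakly centric-radical chain in $\mathcal F$. The local rank $\mathrm{rank}_l(\mathcal F)$ is defined recursively: it is $0$ if $O_p(\mathcal F)=S$, and otherwise $$\mathrm{rank}_l(\mathcal F)=1+\max\{\mathrm{rank}_l(N_{\mathcal F}(R))\mid R\in\mathcal F^{fcr},\ O_p(\mathcal F)<R\}.$$ Then: 1. $\mathrm{rank}_w(\mathcal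 F)=1$ if and only if $\mathcal F^e=\{O_p(\mathcal F)\}$. 2. $\mathrm{rank}_l(\mathcal F)=1$ if and only if $\mathcal F^e=\{O_p(\mathcal F)\}$. -/

import Mathlib

/-- `ψ` extends `φ`: the domain of `φ` lies in the domain of `ψ`, and both have the same values
there. The ambient group `G` only serves to compare the codomains. -/
def Extends {G : Type*} [Group G] {P P' Q Q' : Subgroup G} (ψ : P' →* Q') (φ : P →* Q) : Prop :=
  ∃ h : P ≤ P', ∀ x : P, (ψ (Subgroup.inclusion h x) : G) = φ x

/-- The image `φ(R ∩ P)` of a subgroup `R` under a homomorphism `φ : P → Q`, as a subgroup of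
the ambient group; for `R ≤ P` this is `φ(R)`. -/
def imageIn {G : Type*} [Group G] {P Q : Subgroup G} (φ : P →* Q) (R : Subgroup G) :
    Subgroup G :=
  ((R.subgroupOf P).map φ).map Q.subtype

theorem mem_imageIn {G : Type*} [Group G] {P Q : Subgroup G} (φ : P →* Q) (R : Subgroup G)
    (y : G) : y ∈ imageIn φ R ↔ ∃ x : P, (x : G) ∈ R ∧ (φ x : G) = y := by
  simp only [imageIn, Subgroup.mem_map, Subgroup.mem_subgroupOf, Subgroup.coe_subtype]
  constructor
  · rintro ⟨_, ⟨x, hx, rfl⟩, rfl⟩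
    exact ⟨x, hx, rfl⟩
  · rintro ⟨x, hx, rfl⟩
    exact ⟨_, ⟨x, hx, rfl⟩, rfl⟩

theorem mem_iff_of_imageIn_eq {G : Type*} [Group G] {P Q R : Subgroup G} {φ : P →* Q}
    (h : imageIn φ R = R) (y : G) : y ∈ R ↔ ∃ x : P, (x : G) ∈ R ∧ (φ x : G) = y := by
  conv_lhs => rw [← h]
  exact mem_imageIn φ R y

/-- A fusion system over a `p`-subgroup `base` (usually called `S`) of a finite group `G`. The
group `G` plays no role beyond containing `base`; taking `base = ⊤` gives the fusion systems
over the `p`-group `G` itself. Keeping `G` allows subsystems to live over subgroups of `S`.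

The objects are the subgroups of `base`, the morphisms `P → Q` are the elements of `Hom P Q`
(there are none unless `P` and `Q` are subgroups of `base`). -/
@[ext]
structure FusionSystem (p : ℕ) (G : Type*) [Group G] where
  /-- the underlying `p`-group -/
  base : Subgroup G
  isPGroup_base : IsPGroup p base
  /-- the morphism sets -/
  Hom : ∀ P Q : Subgroup G, Set (P →* Q)
  le_base : ∀ {P Q : Subgroup G} {φ : P →* Q}, φ ∈ Hom P Q → P ≤ base ∧ Q ≤ base
  /-- morphisms can be composed (identities are a special case of `conj_mem`) -/
  comp_mem : ∀ {P Q R : Subgroup G} {φ : P →* Q} {ψ : Q →* R},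
    φ ∈ Hom P Q → ψ ∈ Hom Q R → ψ.comp φ ∈ Hom P R
  /-- `Hom_S(P, Q) ⊆ Hom(P, Q)` -/
  conj_mem : ∀ {P Q : Subgroup G}, P ≤ base → Q ≤ base → ∀ g ∈ base, ∀ φ : P →* Q,
    (∀ x : P, (φ x : G) = g * x * g⁻¹) → φ ∈ Hom P Q
  /-- `Hom(P, Q) ⊆ Inj(P, Q)` -/
  injective : ∀ {P Q : Subgroup G} {φ : P →* Q}, φ ∈ Hom P Q → Function.Injective φ
  /-- every morphism is an isomorphism (in the category) followed by an inclusion -/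
  factor : ∀ {P Q : Subgroup G} {φ : P →* Q}, φ ∈ Hom P Q →
    ∃ (R : Subgroup G) (hR : R ≤ Q) (e : P ≃* R),
      e.toMonoidHom ∈ Hom P R ∧ e.symm.toMonoidHom ∈ Hom R P ∧
        φ = (Subgroup.inclusion hR).comp e.toMonoidHom

namespace FusionSystem

variable {p : ℕ} {G : Type*} [Group G]

/-- Restricting domain and codomain of a morphism gives a morphism. -/
theorem restrict_mem (F : FusionSystem p G) {P P' Q Q' : Subgroup G} {ψ : P' →* Q'}
    (hψ : ψ ∈ F.Hom P' Q') {φ : P →* Q} (hQ : Q ≤ F.base) (h : Extends ψ φ) :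
    φ ∈ F.Hom P Q := by
  obtain ⟨hP, hx⟩ := h
  have hP' := F.le_base hψ
  have h1 : Subgroup.inclusion hP ∈ F.Hom P P' :=
    F.conj_mem (hP.trans hP'.1) hP'.1 1 (one_mem _) _ (by simp)
  obtain ⟨R, hR, e, he, -, hf⟩ := F.factor (F.comp_mem h1 hψ)
  have hval : ∀ x : P, ((e x : R) : G) = φ x := fun x => by
    rw [← hx x]
    have := congrArg (fun f : P →* Q' => ((f x : Q') : G)) hf
    exact this.symm
  have hRQ : R ≤ Q := by
    intro y hy
    obtain ⟨x, hxy⟩ := e.surjective ⟨y, hy⟩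
    have := hval x
    rw [hxy] at this
    change y = _ at this
    rw [this]
    exact (φ x).2
  have h2 : Subgroup.inclusion hRQ ∈ F.Hom R Q :=
    F.conj_mem (hRQ.trans hQ) hQ 1 (one_mem _) _ (by simp)
  have h3 := F.comp_mem he h2
  have : φ = (Subgroup.inclusion hRQ).comp e.toMonoidHom := by
    ext x
    exact (hval x).symm
  rw [this]
  exact h3

/-- A bijective morphism is an isomorphism of the category. -/
theorem symm_mem (F : FusionSystem p G) {P Q : Subgroup G} {e : P ≃* Q}
    (he : e.toMonoidHom ∈ F.Hom P Q) : e.symm.toMonoidHom ∈ F.Hom Q P := by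
  obtain ⟨R, hR, f, -, hf, hfac⟩ := F.factor he
  have hval : ∀ x : P, ((f x : R) : G) = e x := fun x => by
    have := congrArg (fun k : P →* Q => ((k x : Q) : G)) hfac
    exact this.symm
  refine F.restrict_mem hf (F.le_base he).1 ⟨?_, ?_⟩
  · intro y hy
    have := hval (e.symm ⟨y, hy⟩)
    rw [e.apply_symm_apply] at this
    change _ = y at this
    rw [← this]
    exact (f _).2
  · intro y
    have h1 : Subgroup.inclusion (by
        intro y hy
        have := hval (e.symm ⟨y, hy⟩)
        rw [e.apply_symm_apply] at this
        change _ = y at this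
        rw [← this]
        exact (f _).2 : Q ≤ R) y = f (e.symm y) := by
      apply Subtype.ext
      rw [hval, e.apply_symm_apply]
      rfl
    rw [h1]
    change ((f.symm (f (e.symm y)) : P) : G) = _
    rw [f.symm_apply_apply]
    rfl

/-- The identity of an object is a morphism. -/
theorem id_mem (F : FusionSystem p G) {P : Subgroup G} (hP : P ≤ F.base) :
    MonoidHom.id P ∈ F.Hom P P :=
  F.conj_mem hP hP 1 (one_mem _) _ (by simp)

/-- The normaliser `N_S(Q)`. -/
def baseNormalizer (F : FusionSystem p G) (Q : Subgroup G) : Subgroup G :=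
  F.base ⊓ Subgroup.normalizer (Q : Set G)

/-- The normaliser subsystem `N_F(Q)` over `N_S(Q)`. Its morphisms `U → V` are the `φ` in
`Hom_F(U, V)` that extend to some `ψ` in `Hom_F(UQ, VQ)` with `ψ(Q) = Q`. -/
def normalizer (F : FusionSystem p G) (Q : Subgroup G) (hQ : Q ≤ F.base) :
    FusionSystem p G where
  base := F.baseNormalizer Q
  isPGroup_base := F.isPGroup_base.to_le inf_le_left
  Hom U V := {φ | φ ∈ F.Hom U V ∧ U ≤ F.baseNormalizer Q ∧ V ≤ F.baseNormalizer Q ∧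
    ∃ ψ ∈ F.Hom (U ⊔ Q) (V ⊔ Q), Extends ψ φ ∧ imageIn ψ Q = Q}
  le_base h := ⟨h.2.1, h.2.2.1⟩
  comp_mem := by
    rintro U V W φ φ' ⟨h1, hU, hV, ψ, hψ, ⟨e1, e2⟩, hi⟩ ⟨h1', -, hW, ψ', hψ', ⟨e1', e2'⟩, hi'⟩
    refine ⟨F.comp_mem h1 h1', hU, hW, ψ'.comp ψ, F.comp_mem hψ hψ', ⟨e1, fun x => ?_⟩, ?_⟩
    · have : ψ (Subgroup.inclusion e1 x) = Subgroup.inclusion e1' (φ x) :=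
        Subtype.ext (e2 x)
      simp only [MonoidHom.comp_apply]
      rw [this, e2']
    · ext y
      rw [mem_imageIn]
      constructor
      · rintro ⟨x, hx, rfl⟩
        exact (mem_iff_of_imageIn_eq hi' _).2
          ⟨ψ x, (mem_iff_of_imageIn_eq hi _).2 ⟨x, hx, rfl⟩, rfl⟩
      · intro hy
        obtain ⟨z, hz, rfl⟩ := (mem_iff_of_imageIn_eq hi' _).1 hy
        obtain ⟨x, hx, hxz⟩ := (mem_iff_of_imageIn_eq hi _).1 hz
        exact ⟨x, hx, congrArg (fun w => ((ψ' w : ↥(W ⊔ Q)) : G)) (Subtype.ext hxz)⟩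
  conj_mem := by
    intro U V hU hV g hg φ hφ
    have hUb : U ≤ F.base := hU.trans inf_le_left
    have hVb : V ≤ F.base := hV.trans inf_le_left
    have hgn := Subgroup.mem_normalizer_iff.1 hg.2
    have key : U ⊔ Q ≤ (V ⊔ Q).comap (MulAut.conj g).toMonoidHom := by
      refine sup_le (fun x hx => ?_) (fun x hx => ?_)
      · have := (φ ⟨x, hx⟩).2
        rw [hφ ⟨x, hx⟩] at this
        exact (le_sup_left : V ≤ V ⊔ Q) this
      · exact (le_sup_right : Q ≤ V ⊔ Q) ((hgn x).1 hx)
    refine ⟨F.conj_mem hUb hVb g hg.1 φ hφ, hU, hV,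
      ((MulAut.conj g).toMonoidHom.comp (U ⊔ Q).subtype).codRestrict (V ⊔ Q)
        (fun x => key x.2), ?_, ⟨le_sup_left, fun x => ?_⟩, ?_⟩
    · exact F.conj_mem (sup_le hUb hQ) (sup_le hVb hQ) g hg.1 _ (fun x => rfl)
    · rw [hφ]
      rfl
    · ext y
      rw [mem_imageIn]
      constructor
      · rintro ⟨x, hx, rfl⟩
        exact (hgn x).1 hx
      · intro hy
        refine ⟨⟨g⁻¹ * y * g, (le_sup_right : Q ≤ U ⊔ Q) ((hgn _).2 ?_)⟩, (hgn _).2 ?_, ?_⟩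
        · simpa [mul_assoc] using hy
        · simpa [mul_assoc] using hy
        · change g * (g⁻¹ * y * g) * g⁻¹ = y
          group
  injective h := F.injective h.1
  factor := by
    rintro U V φ ⟨h1, hU, hV, ψ, hψ, ⟨e1, e2⟩, hi⟩
    obtain ⟨R, hR, e, he, he', rfl⟩ := F.factor h1
    obtain ⟨T, hT, f, hf, hf', rfl⟩ := F.factor hψ
    have hval : ∀ x : U, ((f (Subgroup.inclusion e1 x) : T) : G) = (e x : R) := fun x => e2 x
    have himg : ∀ y, y ∈ Q ↔ ∃ x : ↥(U ⊔ Q), (x : G) ∈ Q ∧ ((f x : T) : G) = y :=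
      mem_iff_of_imageIn_eq hi
    have hRT : R ≤ T := by
      intro y hy
      have := hval (e.symm ⟨y, hy⟩)
      rw [e.apply_symm_apply] at this
      change _ = y at this
      rw [← this]
      exact (f _).2
    have hQT : Q ≤ T := by
      intro y hy
      obtain ⟨x, -, rfl⟩ := (himg y).1 hy
      exact (f x).2
    have hle : U ⊔ Q ≤ ((R ⊔ Q).comap (T.subtype.comp f.toMonoidHom)).map (U ⊔ Q).subtype := by
      refine sup_le (fun x hx => ?_) (fun x hx => ?_)
      · refine ⟨Subgroup.inclusion e1 ⟨x, hx⟩, ?_, rfl⟩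
        change ((f (Subgroup.inclusion e1 ⟨x, hx⟩) : T) : G) ∈ R ⊔ Q
        rw [hval]
        exact (le_sup_left : R ≤ R ⊔ Q) (e ⟨x, hx⟩).2
      · refine ⟨⟨x, (le_sup_right : Q ≤ U ⊔ Q) hx⟩, ?_, rfl⟩
        exact (le_sup_right : Q ≤ R ⊔ Q) ((himg _).2 ⟨_, hx, rfl⟩)
    have hTeq : T = R ⊔ Q := by
      refine le_antisymm (fun y hy => ?_) (sup_le hRT hQT)
      obtain ⟨x, hx, hx'⟩ := hle (f.symm ⟨y, hy⟩).2
      have hxe : x = f.symm ⟨y, hy⟩ := Subtype.ext hx'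
      rw [hxe] at hx
      change ((f (f.symm ⟨y, hy⟩) : T) : G) ∈ R ⊔ Q at hx
      rwa [f.apply_symm_apply] at hx
    subst hTeq
    refine ⟨R, hR, e, ⟨he, hU, hR.trans hV, f.toMonoidHom, hf, ⟨e1, hval⟩, ?_⟩,
      ⟨he', hR.trans hV, hU, f.symm.toMonoidHom, hf', ⟨le_sup_left, fun y => ?_⟩, ?_⟩, rfl⟩
    · ext y
      rw [mem_imageIn]
      exact (himg y).symm
    · obtain ⟨x, rfl⟩ := e.surjective y
      have : Subgroup.inclusion (le_sup_left : R ≤ R ⊔ Q) (e x) = f (Subgroup.inclusion e1 x) :=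
        Subtype.ext (hval x).symm
      rw [this]
      change ((f.symm (f (Subgroup.inclusion e1 x)) : ↥(U ⊔ Q)) : G) = (e.symm (e x) : U)
      rw [f.symm_apply_apply, e.symm_apply_apply]
      rfl
    · ext y
      rw [mem_imageIn]
      constructor
      · rintro ⟨x, hx, rfl⟩
        obtain ⟨z, hz, hzx⟩ := (himg _).1 hx
        have : x = f z := Subtype.ext hzx.symm
        rw [this]
        change ((f.symm (f z) : ↥(U ⊔ Q)) : G) ∈ Q
        rwa [f.symm_apply_apply]
      · intro hy
        refine ⟨f ⟨y, (le_sup_right : Q ≤ U ⊔ Q) hy⟩, (himg _).2 ⟨_, hy, rfl⟩, ?_⟩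
        change ((f.symm (f _) : ↥(U ⊔ Q)) : G) = y
        rw [f.symm_apply_apply]

/-- `Q` is normal in `F`: `N_F(Q) = F`. -/
def IsNormal (F : FusionSystem p G) (Q : Subgroup G) : Prop :=
  ∃ hQ : Q ≤ F.base, F.normalizer Q hQ = F

/-- `O_p(F)`, the largest subgroup of `S` that is normal in `F` (products of normal subgroups
of `F` are normal in `F`, so it is the subgroup generated by all of them). -/
def pCore (F : FusionSystem p G) : Subgroup G :=
  sSup {Q | F.IsNormal Q}

/-- `P` and `Q` are `F`-conjugate: they are isomorphic objects of `F`. -/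
def IsConj (F : FusionSystem p G) (P Q : Subgroup G) : Prop :=
  ∃ e : P ≃* Q, e.toMonoidHom ∈ F.Hom P Q ∧ e.symm.toMonoidHom ∈ F.Hom Q P

/-- The automorphism group `Aut_F(Q)`. -/
def aut (F : FusionSystem p G) (Q : Subgroup G) (hQ : Q ≤ F.base) : Subgroup (MulAut Q) where
  carrier := {α | α.toMonoidHom ∈ F.Hom Q Q}
  one_mem' := F.id_mem hQ
  mul_mem' ha hb := F.comp_mem hb ha
  inv_mem' ha := F.symm_mem ha

/-- `Aut_S(Q)`, the automorphisms of `Q` induced by conjugation with elements of `N_S(Q)`. -/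
def autBase (F : FusionSystem p G) (Q : Subgroup G) : Subgroup (MulAut Q) :=
  (F.base.subgroupOf (Subgroup.normalizer (Q : Set G))).map Q.normalizerMonoidHom

/-- `Inn(Q)` as a subgroup of `Aut_F(Q)`. -/
def inn (F : FusionSystem p G) (Q : Subgroup G) (hQ : Q ≤ F.base) : Subgroup (F.aut Q hQ) :=
  (MulAut.conj : Q →* MulAut Q).range.subgroupOf (F.aut Q hQ)

instance inn_normal (F : FusionSystem p G) (Q : Subgroup G) (hQ : Q ≤ F.base) :
    (F.inn Q hQ).Normal := by
  constructor
  rintro α ⟨x, hx⟩ β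
  refine ⟨(β : MulAut Q) x, ?_⟩
  ext y
  have h : MulAut.conj x ((β : MulAut Q)⁻¹ y) = (α : MulAut Q) ((β : MulAut Q)⁻¹ y) := by
    rw [hx]
    rfl
  have h' := congrArg (fun z => (((β : MulAut Q) z : Q) : G)) h
  simpa using h'

/-- The outer automorphism group `Out_F(Q) = Aut_F(Q) / Inn(Q)`. -/
abbrev Out (F : FusionSystem p G) (Q : Subgroup G) (hQ : Q ≤ F.base) : Type _ :=
  F.aut Q hQ ⧸ F.inn Q hQ

/-- `N_φ = {g ∈ N_S(P) | φ ∘ c_g ∘ φ⁻¹ ∈ Aut_S(Q)}` for an isomorphism `φ : P → Q`. -/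
def extDomain (F : FusionSystem p G) {P Q : Subgroup G} (φ : P ≃* Q) : Subgroup G :=
  F.base ⊓ ((F.autBase Q).comap
    ((MulAut.congr φ).toMonoidHom.comp P.normalizerMonoidHom)).map
      (Subgroup.normalizer (P : Set G)).subtype

/-- `Q` is fully `F`-automised: `Aut_S(Q)` is a Sylow `p`-subgroup of `Aut_F(Q)`. -/
def IsFullyAutomised (F : FusionSystem p G) (Q : Subgroup G) : Prop :=
  ∃ hQ : Q ≤ F.base, ∃ T : Sylow p (F.aut Q hQ),
    (T : Subgroup (F.aut Q hQ)) = (F.autBase Q).subgroupOf (F.aut Q hQ)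

/-- `Q` is `F`-receptive: every `F`-isomorphism `φ : P → Q` extends to a morphism `N_φ → S`. -/
def IsReceptive (F : FusionSystem p G) (Q : Subgroup G) : Prop :=
  Q ≤ F.base ∧ ∀ (P : Subgroup G) (φ : P ≃* Q), φ.toMonoidHom ∈ F.Hom P Q →
    ∃ ψ ∈ F.Hom (F.extDomain φ) F.base, Extends ψ φ.toMonoidHom

/-- `F` is saturated: each subgroup of `S` is `F`-conjugate to one that is fully automised and
receptive. -/
def IsSaturated (F : FusionSystem p G) : Prop :=
  ∀ P : Subgroup G, P ≤ F.base →
    ∃ Q : Subgroup G, F.IsConj P Q ∧ F.IsFullyAutomised Q ∧ F.IsReceptive Q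

/-- `Q` is fully `F`-normalised: `|N_S(P)| ≤ |N_S(Q)|` for all `F`-conjugates `P` of `Q`. -/
def IsFullyNormalised (F : FusionSystem p G) (Q : Subgroup G) : Prop :=
  Q ≤ F.base ∧ ∀ P : Subgroup G, F.IsConj Q P →
    Nat.card (F.baseNormalizer P) ≤ Nat.card (F.baseNormalizer Q)

/-- `Q` is `F`-centric: `C_S(P) = Z(P)` for all `F`-conjugates `P` of `Q`. -/
def IsCentric (F : FusionSystem p G) (Q : Subgroup G) : Prop :=
  Q ≤ F.base ∧ ∀ P : Subgroup G, F.IsConj Q P →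
    F.base ⊓ Subgroup.centralizer (P : Set G) = (Subgroup.center P).map P.subtype

/-- `O_p(H)` for a finite group `H`: the subgroup generated by all normal `p`-subgroups, which is
the largest normal `p`-subgroup. -/
def groupPCore (p : ℕ) (H : Type*) [Group H] : Subgroup H :=
  sSup {N | N.Normal ∧ IsPGroup p N}

/-- `Q` is `F`-radical: `O_p(Out_F(Q)) = 1`. -/
def IsRadical (F : FusionSystem p G) (Q : Subgroup G) : Prop :=
  ∃ hQ : Q ≤ F.base, groupPCore p (F.Out Q hQ) = ⊥

/-- `M` is a strongly `p`-embedded subgroup of `H`: it is proper, `p` divides `|M|`, and `p` does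
not divide `|M ∩ xMx⁻¹|` for `x ∈ H \ M`. -/
def IsStronglyEmbedded (p : ℕ) {H : Type*} [Group H] (M : Subgroup H) : Prop :=
  M ≠ ⊤ ∧ p ∣ Nat.card M ∧
    ∀ x : H, x ∉ M → ¬ p ∣ Nat.card ↥(M ⊓ M.map (MulAut.conj x).toMonoidHom)

/-- `Q` is `F`-essential: it is fully normalised and centric, and `Out_F(Q)` has a strongly
`p`-embedded subgroup. -/
def IsEssential (F : FusionSystem p G) (Q : Subgroup G) : Prop :=
  F.IsFullyNormalised Q ∧ F.IsCentric Q ∧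
    ∃ hQ : Q ≤ F.base, ∃ M : Subgroup (F.Out Q hQ), IsStronglyEmbedded p M

/-- `Q` is weakly centric-radical in `F`: `O_p(N_F(Q)) = Q`. -/
def IsWeaklyCentricRadical (F : FusionSystem p G) (Q : Subgroup G) : Prop :=
  ∃ hQ : Q ≤ F.base, (F.normalizer Q hQ).pCore = Q

/-- `Q₀ < Q₁ < ⋯ < Qₙ` is a weakly centric-radical chain in `F`: `N_F(Q₀) = F`, `O_p(F) < Q₁`
(if `n ≥ 1`), and `Q_i` is weakly centric-radical in `N_F(σ_{i-1})` for `1 ≤ i ≤ n`. The systems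
`E i = N_F(σ_i)` are given recursively by `N_F(σ_0) = N_F(Q₀) = F` and
`N_F(σ_i) = N_{N_F(σ_{i-1})}(Q_i)`. -/
def IsWeaklyCentricRadicalChain (F : FusionSystem p G) (σ : LTSeries (Subgroup G)) : Prop :=
  F.IsNormal (σ 0) ∧
  (∀ h : 0 < σ.length, F.pCore < σ (Fin.succ ⟨0, h⟩)) ∧
  ∃ E : Fin (σ.length + 1) → FusionSystem p G, E 0 = F ∧
    ∀ i : Fin σ.length, (E i.castSucc).IsWeaklyCentricRadical (σ i.succ) ∧
      ∃ h : σ i.succ ≤ (E i.castSucc).base, E i.succ = (E i.castSucc).normalizer (σ i.succ) h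

/-- The weakly local rank `rank_w(F)`: the length of a longest weakly centric-radical chain. -/
noncomputable def weaklyLocalRank (F : FusionSystem p G) : ℕ :=
  sSup {n | ∃ σ : LTSeries (Subgroup G), F.IsWeaklyCentricRadicalChain σ ∧ σ.length = n}

/-- `Q` belongs to `F^{fcr}` and properly contains `O_p(F)`, so that `N_F(Q)` is a parabolic
subsystem of `F`. -/
structure IsParabolic (F : FusionSystem p G) (Q : Subgroup G) : Prop where
  fullyNormalised : F.IsFullyNormalised Q
  centric : F.IsCentric Q
  radical : F.IsRadical Q
  pCore_lt : F.pCore < Q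

theorem IsNormal.le_pCore {F : FusionSystem p G} {Q : Subgroup G} (h : F.IsNormal Q) :
    Q ≤ F.pCore :=
  le_sSup h

theorem pCore_le_base (F : FusionSystem p G) : F.pCore ≤ F.base :=
  sSup_le fun _ h => h.1

theorem isNormal_normalizer (F : FusionSystem p G) (Q : Subgroup G) (hQ : Q ≤ F.base) :
    (F.normalizer Q hQ).IsNormal Q := by
  have hb : Q ≤ F.baseNormalizer Q := le_inf hQ Subgroup.le_normalizer
  refine ⟨hb, ?_⟩
  have hbase : (F.normalizer Q hQ).baseNormalizer Q = F.baseNormalizer Q :=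
    inf_eq_left.2 inf_le_right
  refine FusionSystem.ext hbase ?_
  funext U V
  ext φ
  constructor
  · exact fun h => h.1
  · intro h
    obtain ⟨hφ, hU, hV, ψ, hψ, hext, him⟩ := id h
    refine ⟨h, hU.trans hbase.ge, hV.trans hbase.ge, ψ,
      ⟨hψ, sup_le hU hb, sup_le hV hb, ?_⟩, hext, him⟩
    have hUQ : U ⊔ Q ⊔ Q = U ⊔ Q := by rw [sup_assoc, sup_idem]
    have hVQ : V ⊔ Q ⊔ Q = V ⊔ Q := by rw [sup_assoc, sup_idem]
    refine ⟨((Subgroup.inclusion hVQ.ge).comp ψ).comp (Subgroup.inclusion hUQ.le),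
      F.restrict_mem hψ (hVQ.le.trans (F.le_base hψ).2) ⟨hUQ.le, fun x => rfl⟩,
      ⟨hUQ.ge, fun x => rfl⟩, ?_⟩
    ext y
    rw [mem_imageIn, mem_iff_of_imageIn_eq him]
    constructor
    · rintro ⟨x, hx, rfl⟩
      exact ⟨Subgroup.inclusion hUQ.le x, hx, rfl⟩
    · rintro ⟨x, hx, rfl⟩
      exact ⟨Subgroup.inclusion hUQ.ge x, hx, rfl⟩

theorem rank_decreasing [Finite G] {F : FusionSystem p G} {Q : Subgroup G}
    (h : F.IsParabolic Q) :
    Nat.card (F.normalizer Q h.fullyNormalised.1).base -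
        Nat.card (F.normalizer Q h.fullyNormalised.1).pCore <
      Nat.card F.base - Nat.card F.pCore := by
  have hQ := h.fullyNormalised.1
  have h1 : Nat.card (F.normalizer Q hQ).base ≤ Nat.card F.base :=
    Subgroup.card_le_of_le (inf_le_left : F.baseNormalizer Q ≤ F.base)
  have h2 : Nat.card Q ≤ Nat.card (F.normalizer Q hQ).pCore :=
    Subgroup.card_le_of_le (F.isNormal_normalizer Q hQ).le_pCore
  have h3 : Nat.card F.pCore < Nat.card Q :=
    Set.ncard_lt_ncard (s := (F.pCore : Set G)) (t := (Q : Set G)) h.pCore_lt (Set.toFinite _)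
  have h4 : Nat.card Q ≤ Nat.card F.base := Subgroup.card_le_of_le hQ
  omega

/-- The local rank `rank_l(F)`: it is `0` if `O_p(F) = S`, and otherwise one more than the maximum
of the local ranks of `N_F(R)` over all `R ∈ F^{fcr}` with `O_p(F) < R`. -/
noncomputable def localRank [Finite G] (F : FusionSystem p G) : ℕ :=
  open Classical in
  if F.pCore = F.base then 0
  else 1 + ⨆ R : {R : Subgroup G // F.IsParabolic R},
    localRank (F.normalizer R.1 R.2.fullyNormalised.1)
termination_by Nat.card F.base - Nat.card F.pCore
decreasing_by exact rank_decreasing R.2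

end FusionSystem

/-!
For a saturated fusion system `F` over `S`, both ranks are positive exactly when `O_p(F) ≠ S`, as
witnessed by `O_p(F) < S`, and a rank above `1` needs a subgroup `R > O_p(F)` for which
`N_S(R)` is larger than `O_p(N_F(R))`. Two facts link the existence of such `R` to essential
subgroups.

*Essential subgroups are terms of chains.* An essential subgroup `E` is radical, since a group with
a strongly `p`-embedded subgroup has no nontrivial normal `p`-subgroup
(`IsStronglyEmbedded.groupPCore_eq_bot`). Hence `O_p(F) ≤ E` and `O_p(N_F(E)) = E`: a subgroup `T`
of `N_S(E)` that is stable under extensions of all `F`-automorphisms of `E` yields a normal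
`p`-subgroup of `Out_F(E)` (`le_of_isRadical`). So if `E ≠ O_p(F)`, then `O_p(F) < E`, and either
`E = S`, which is not essential, or `O_p(F) < E < N_S(E)` shows that the ranks exceed `1`.

*Above the essential subgroups, fusion is controlled by `Aut_F(S)`.* If `P` is larger than every
essential subgroup, each morphism from `P` extends to an element of `Aut_F(S)`
(`IsSaturated.extendsToBase`). This is proved by downward induction on `|P|`. Saturation and the
induction reduce the claim to automorphisms of a fully automised receptive conjugate `Q` of `P`, and
an automorphism whose extension domain is larger than `Q` causes no difficulty. If some automorphism
did not extend, then `Q` would be centric and those that extend would give a strongly `p`-embedded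
subgroup of `Out_F(Q)`, making `Q` essential (`IsFullyAutomised.isEssential`).

If there are no essential subgroups, this gives that `S` is normal in `F`. If `O_p(F)` is the only
one, it gives that `N_S(R)` is normal in `N_F(R)` for all `R > O_p(F)`
(`isNormal_baseNormalizer`), so that no chain goes beyond `O_p(F) < S`.
-/

namespace FusionSystem

/-! ### Strongly embedded subgroups of finite groups -/

section StronglyEmbedded

variable {p : ℕ} {H : Type*} [Group H] {M : Subgroup H}

theorem IsStronglyEmbedded.mem_of_conj_mem (hM : IsStronglyEmbedded p M) {x y : H}
    (hy : y ∈ M) (hyp : orderOf y = p) (hxy : x⁻¹ * y * x ∈ M) : x ∈ M := by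
  by_contra hx
  refine hM.2.2 x hx ?_
  have hmem : y ∈ M ⊓ M.map (MulAut.conj x).toMonoidHom :=
    ⟨hy, x⁻¹ * y * x, hxy, by simp [mul_assoc]⟩
  rw [← hyp]
  exact Subgroup.orderOf_dvd_natCard _ hmem

/-- A nontrivial normal `p`-subgroup `N` would lie in the strongly embedded subgroup `M`: if
`y ∈ M` has order `p`, a central element of order `p` of the `p`-group `N⟨y⟩` commutes with `y`,
hence lies in `M`, and it commutes with `N`, so that `N ≤ M` as well. -/
theorem IsStronglyEmbedded.groupPCore_eq_bot [Finite H] [Fact p.Prime]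
    (hM : IsStronglyEmbedded p M) : groupPCore p H = ⊥ := by
  refine le_bot_iff.1 (sSup_le ?_)
  rintro N ⟨hN, hNp⟩
  by_contra hbot
  obtain ⟨⟨y, hyM⟩, hy⟩ := exists_prime_orderOf_dvd_card' p hM.2.1
  rw [Subgroup.orderOf_mk] at hy
  have hyp : IsPGroup p (Subgroup.zpowers y) :=
    IsPGroup.of_card (n := 1) (by rw [Nat.card_zpowers, hy, pow_one])
  have hP : IsPGroup p ↥(N ⊔ Subgroup.zpowers y) := hNp.to_sup_of_normal_left hyp
  have hNnt : Nontrivial N := (Subgroup.nontrivial_iff_ne_bot N).2 fun h => hbot h.le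
  have : Nontrivial ↥(N ⊔ Subgroup.zpowers y) :=
    (Subgroup.inclusion_injective (le_sup_left : N ≤ N ⊔ Subgroup.zpowers y)).nontrivial
  have hcnt := hP.center_nontrivial
  obtain ⟨n, hn0, hn⟩ := (IsPGroup.nontrivial_iff_card (hP.to_subgroup _)).1 hcnt
  obtain ⟨⟨⟨w, hwP⟩, hwc⟩, hw⟩ := exists_prime_orderOf_dvd_card'
    (G := Subgroup.center ↥(N ⊔ Subgroup.zpowers y)) p (hn ▸ dvd_pow_self p hn0.ne')
  rw [Subgroup.orderOf_mk, Subgroup.orderOf_mk] at hw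
  have hcomm : ∀ a ∈ N ⊔ Subgroup.zpowers y, a * w = w * a := fun a ha =>
    congrArg Subtype.val (Subgroup.mem_center_iff.1 hwc ⟨a, ha⟩)
  have hwM : w ∈ M := by
    refine hM.mem_of_conj_mem hyM hy ?_
    rw [mul_assoc, hcomm y ((le_sup_right : _ ≤ N ⊔ Subgroup.zpowers y)
      (Subgroup.mem_zpowers y)), inv_mul_cancel_left]
    exact hyM
  have hNM : N ≤ M := by
    intro a ha
    refine hM.mem_of_conj_mem hwM hw ?_
    rw [mul_assoc, ← hcomm a ((le_sup_left : N ≤ N ⊔ Subgroup.zpowers y) ha),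
      inv_mul_cancel_left]
    exact hwM
  obtain ⟨x, hx⟩ : ∃ x, x ∉ M := by
    by_contra! h
    exact hM.1 ((Subgroup.eq_top_iff' M).2 h)
  refine hM.2.2 x hx ?_
  have hNle : N ≤ M ⊓ M.map (MulAut.conj x).toMonoidHom := fun a ha =>
    ⟨hNM ha, x⁻¹ * a * x, hNM (by simpa using hN.conj_mem a ha x⁻¹), by simp [mul_assoc]⟩
  obtain ⟨k, hk0, hk⟩ := (IsPGroup.nontrivial_iff_card hNp).1 hNnt
  exact (hk ▸ dvd_pow_self p hk0.ne').trans (Subgroup.card_dvd_of_le hNle)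

theorem exists_conj_mem_sylow [Finite H] [Fact p.Prime] (T : Sylow p H) (hTM : (T : Subgroup H) ≤ M)
    {y : H} (hy : y ∈ M) (hyp : orderOf y = p) : ∃ m ∈ M, m⁻¹ * y * m ∈ T := by
  have hy' : IsPGroup p (Subgroup.zpowers (⟨y, hy⟩ : M)) :=
    IsPGroup.of_card (n := 1) (by rw [Nat.card_zpowers, Subgroup.orderOf_mk, hyp, pow_one])
  obtain ⟨Q, hQ⟩ := hy'.exists_le_sylow
  obtain ⟨m, rfl⟩ := MulAction.exists_smul_eq M (T.subtype hTM) Q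
  have h := hQ (Subgroup.mem_zpowers _)
  rw [Sylow.coe_subgroup_smul, Subgroup.mem_pointwise_smul_iff_inv_smul_mem] at h
  refine ⟨m, m.2, ?_⟩
  have h' : (((MulAut.conj m)⁻¹ • (⟨y, hy⟩ : M) : M) : H) = (m : H)⁻¹ * y * m := by
    rw [← map_inv]
    simp [MulAut.smul_def]
  rw [← h']
  exact h

/-- A proper subgroup containing a nontrivial Sylow `p`-subgroup `T`, and every `g` for which
`T ∩ gTg⁻¹` is nontrivial, is strongly `p`-embedded. -/
theorem isStronglyEmbedded_of_sylow [Finite H] [Fact p.Prime] (T : Sylow p H)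
    (hTM : (T : Subgroup H) ≤ M) (hM : M ≠ ⊤) (hT : (T : Subgroup H) ≠ ⊥)
    (h : ∀ g t : H, t ∈ T → t ≠ 1 → g⁻¹ * t * g ∈ T → g ∈ M) : IsStronglyEmbedded p M := by
  refine ⟨hM, ?_, fun x hx hdvd => hx ?_⟩
  · obtain ⟨k, hk0, hk⟩ := (IsPGroup.nontrivial_iff_card T.2).1
      ((Subgroup.nontrivial_iff_ne_bot _).2 hT)
    exact (hk ▸ dvd_pow_self p hk0.ne').trans (Subgroup.card_dvd_of_le hTM)
  obtain ⟨⟨y, hyM'⟩, hy⟩ := exists_prime_orderOf_dvd_card' p hdvd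
  rw [Subgroup.orderOf_mk] at hy
  obtain ⟨hyM, z, hzM, hzy⟩ := hyM'
  have hzy' : y = x * z * x⁻¹ := by simpa using hzy.symm
  have hz : orderOf z = p := by
    rw [← hy, ← hzy]
    exact (orderOf_injective _ (MulAut.conj x).injective z).symm
  obtain ⟨m, hm, hmy⟩ := exists_conj_mem_sylow T hTM hyM hy
  obtain ⟨m', hm', hmz⟩ := exists_conj_mem_sylow T hTM hzM hz
  have hg : m⁻¹ * x * m' ∈ M := by
    refine h _ _ hmy (fun h1 => ?_) ?_
    · have h2 : y = 1 := by
        have := congrArg (fun a => m * a * m⁻¹) h1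
        simpa [mul_assoc] using this
      rw [h2, orderOf_one] at hy
      exact (Fact.out : p.Prime).one_lt.ne hy
    · rw [hzy']
      simpa [mul_assoc] using hmz
  simpa [mul_assoc] using M.mul_mem (M.mul_mem hm hg) (M.inv_mem hm')

end StronglyEmbedded

/-! ### Normalisers in `p`-groups and automorphisms induced by conjugation -/

section Groups

variable {G : Type*} [Group G]

theorem exists_mem_normalizer_notMem [Finite G] {p : ℕ} [Fact p.Prime] {S Q : Subgroup G}
    (hS : IsPGroup p S) (hQ : Q < S) :
    ∃ x ∈ S, x ∈ Subgroup.normalizer (Q : Set G) ∧ x ∉ Q := by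
  have := hS.isNilpotent
  have hlt : Q.subgroupOf S < ⊤ := by
    rw [lt_top_iff_ne_top, Ne, Subgroup.subgroupOf_eq_top]
    exact hQ.not_ge
  obtain ⟨-, x, hx, hxQ⟩ := SetLike.lt_iff_le_and_exists.1
    (Group.normalizerCondition_of_isNilpotent _ hlt)
  refine ⟨x, x.2, Subgroup.mem_normalizer_iff.2 fun y => ?_, fun h => hxQ h⟩
  rw [Subgroup.mem_normalizer_iff] at hx
  constructor
  · exact fun hy => (hx ⟨y, hQ.le hy⟩).1 hy
  · intro hy
    have hyS : y ∈ S := by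
      have := S.mul_mem (S.mul_mem (S.inv_mem x.2) (hQ.le hy)) x.2
      simpa [mul_assoc] using this
    exact (hx ⟨y, hyS⟩).2 hy

/-- `Aut_T(Q)`: the automorphisms of `Q` induced by conjugation with elements of `N_T(Q)`. -/
def autOf (T Q : Subgroup G) : Subgroup (MulAut Q) :=
  (T.subgroupOf (Subgroup.normalizer (Q : Set G))).map Q.normalizerMonoidHom

theorem mem_autOf {T Q : Subgroup G} {α : MulAut Q} :
    α ∈ autOf T Q ↔ ∃ g ∈ T, g ∈ Subgroup.normalizer (Q : Set G) ∧
      ∀ x : Q, (α x : G) = g * x * g⁻¹ := by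
  constructor
  · rintro ⟨g, hg, rfl⟩
    exact ⟨g, hg, g.2, fun x => rfl⟩
  · rintro ⟨g, hg, hgn, h⟩
    refine ⟨⟨g, hgn⟩, hg, ?_⟩
    ext x
    exact (h x).symm

theorem isPGroup_autOf {p : ℕ} {T : Subgroup G} (hT : IsPGroup p T) (Q : Subgroup G) :
    IsPGroup p (autOf T Q) :=
  (hT.comap_of_injective _ Subtype.val_injective).map _

end Groups

variable {p : ℕ} {G : Type*} [Group G] {F : FusionSystem p G}

theorem mem_autBase {Q : Subgroup G} {α : MulAut Q} :
    α ∈ F.autBase Q ↔ ∃ g ∈ F.base, g ∈ Subgroup.normalizer (Q : Set G) ∧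
      ∀ x : Q, (α x : G) = g * x * g⁻¹ :=
  mem_autOf

theorem mem_extDomain {P Q : Subgroup G} {φ : P ≃* Q} {g : G} :
    g ∈ F.extDomain φ ↔ g ∈ F.base ∧ ∃ hg : g ∈ Subgroup.normalizer (P : Set G),
      (φ.symm.trans (P.normalizerMonoidHom ⟨g, hg⟩)).trans φ ∈ F.autBase Q := by
  constructor
  · rintro ⟨hg, ⟨g', hgn⟩, h, rfl⟩
    exact ⟨hg, hgn, h⟩
  · rintro ⟨hg, hgn, h⟩
    exact ⟨hg, ⟨g, hgn⟩, h, rfl⟩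

theorem autOf_le_aut {T Q : Subgroup G} (hT : T ≤ F.base) (hQ : Q ≤ F.base) :
    autOf T Q ≤ F.aut Q hQ := by
  intro α hα
  obtain ⟨g, hg, -, h⟩ := mem_autOf.1 hα
  exact F.conj_mem hQ hQ g (hT hg) _ h

theorem autBase_le_aut {Q : Subgroup G} (hQ : Q ≤ F.base) : F.autBase Q ≤ F.aut Q hQ :=
  autOf_le_aut le_rfl hQ

theorem mem_inn {Q : Subgroup G} {hQ : Q ≤ F.base} {α : F.aut Q hQ} :
    α ∈ F.inn Q hQ ↔ ∃ g ∈ Q, ∀ x : Q, ((α : MulAut Q) x : G) = g * x * g⁻¹ := by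
  constructor
  · rintro ⟨g, hg⟩
    refine ⟨g, g.2, fun x => ?_⟩
    rw [Subgroup.coe_subtype] at hg
    rw [← hg]
    rfl
  · rintro ⟨g, hg, h⟩
    refine ⟨⟨g, hg⟩, ?_⟩
    ext x
    exact (h x).symm

/-! ### Normal subgroups of a fusion system -/

theorem imageIn_sup {P Q A B : Subgroup G} (φ : P →* Q) (hA : A ≤ P) (hB : B ≤ P) :
    imageIn φ (A ⊔ B) = imageIn φ A ⊔ imageIn φ B := by
  rw [imageIn, Subgroup.subgroupOf_sup hA hB, Subgroup.map_sup, Subgroup.map_sup]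
  rfl

theorem imageIn_congr {P Q P' Q' A : Subgroup G} {φ : P →* Q} {φ' : P' →* Q'} (hA : A ≤ P)
    (hA' : A ≤ P') (h : ∀ (x : G) (hx : x ∈ A), (φ ⟨x, hA hx⟩ : G) = φ' ⟨x, hA' hx⟩) :
    imageIn φ A = imageIn φ' A := by
  ext y
  rw [mem_imageIn, mem_imageIn]
  constructor
  · rintro ⟨x, hx, rfl⟩
    exact ⟨⟨x, hA' hx⟩, hx, (h x hx).symm⟩
  · rintro ⟨x, hx, rfl⟩
    exact ⟨⟨x, hA hx⟩, hx, h x hx⟩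

theorem isNormal_iff {Q : Subgroup G} :
    F.IsNormal Q ↔ Q ≤ F.base ∧ F.base ≤ Subgroup.normalizer (Q : Set G) ∧
      ∀ (U V : Subgroup G) (φ : U →* V), φ ∈ F.Hom U V →
        ∃ ψ ∈ F.Hom (U ⊔ Q) (V ⊔ Q), Extends ψ φ ∧ imageIn ψ Q = Q := by
  constructor
  · rintro ⟨hQ, h⟩
    refine ⟨hQ, inf_eq_left.1 (congrArg base h), fun U V φ hφ => ?_⟩
    have h' : φ ∈ (F.normalizer Q hQ).Hom U V := by rwa [h]
    exact h'.2.2.2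
  · rintro ⟨hQ, hn, h⟩
    have hb : F.baseNormalizer Q = F.base := inf_eq_left.2 hn
    refine ⟨hQ, FusionSystem.ext hb ?_⟩
    funext U V
    ext φ
    refine ⟨fun hφ => hφ.1, fun hφ => ⟨hφ, ?_, ?_, h U V φ hφ⟩⟩
    · rw [hb]
      exact (F.le_base hφ).1
    · rw [hb]
      exact (F.le_base hφ).2

theorem isNormal_bot (F : FusionSystem p G) : F.IsNormal ⊥ := by
  refine isNormal_iff.2 ⟨bot_le, fun g _ => Subgroup.mem_normalizer_iff.2 (by simp),
    fun U V φ hφ => ?_⟩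
  have hU : U ⊔ ⊥ = U := sup_bot_eq U
  have hV : V ≤ V ⊔ ⊥ := le_sup_left
  refine ⟨(Subgroup.inclusion hV).comp (φ.comp (Subgroup.inclusion hU.le)),
    F.restrict_mem hφ (sup_le (F.le_base hφ).2 bot_le) ⟨hU.le, fun x => rfl⟩,
    ⟨le_sup_left, fun x => rfl⟩, ?_⟩
  ext y
  rw [mem_imageIn, Subgroup.mem_bot]
  constructor
  · rintro ⟨x, hx, rfl⟩
    rw [show x = 1 from Subtype.ext (Subgroup.mem_bot.1 hx), map_one]
    rfl
  · rintro rfl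
    exact ⟨1, one_mem _, by rw [map_one]; rfl⟩

theorem normalizer_bot (F : FusionSystem p G) : F.normalizer ⊥ bot_le = F :=
  F.isNormal_bot.2

theorem IsNormal.sup {Q R : Subgroup G} (hQ : F.IsNormal Q) (hR : F.IsNormal R) :
    F.IsNormal (Q ⊔ R) := by
  obtain ⟨hQb, hQn, hQe⟩ := isNormal_iff.1 hQ
  obtain ⟨hRb, hRn, hRe⟩ := isNormal_iff.1 hR
  refine isNormal_iff.2 ⟨sup_le hQb hRb, fun g hg => ?_, fun U V φ hφ => ?_⟩
  · have key : ∀ g ∈ F.base, Q ⊔ R ≤ (Q ⊔ R).comap (MulAut.conj g).toMonoidHom := fun g hg =>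
      sup_le
        (fun x hx => (le_sup_left : Q ≤ Q ⊔ R) ((Subgroup.mem_normalizer_iff.1 (hQn hg) x).1 hx))
        (fun x hx => (le_sup_right : R ≤ Q ⊔ R) ((Subgroup.mem_normalizer_iff.1 (hRn hg) x).1 hx))
    refine Subgroup.mem_normalizer_iff.2 fun x => ⟨fun hx => key g hg hx, fun hx => ?_⟩
    simpa [mul_assoc] using key g⁻¹ (inv_mem hg) hx
  · obtain ⟨ψ, hψ, ⟨e1, e2⟩, hi⟩ := hQe U V φ hφ
    obtain ⟨χ, hχ, ⟨f1, f2⟩, hj⟩ := hRe _ _ ψ hψ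
    have hU : U ⊔ (Q ⊔ R) = U ⊔ Q ⊔ R := (sup_assoc _ _ _).symm
    have hV : V ⊔ Q ⊔ R = V ⊔ (Q ⊔ R) := sup_assoc _ _ _
    have hVb : V ⊔ (Q ⊔ R) ≤ F.base := sup_le (F.le_base hφ).2 (sup_le hQb hRb)
    refine ⟨(Subgroup.inclusion hV.le).comp (χ.comp (Subgroup.inclusion hU.le)),
      F.restrict_mem hχ hVb ⟨hU.le, fun x => rfl⟩,
      ⟨le_sup_left, fun x => ?_⟩, ?_⟩
    · rw [← e2 x, ← f2]
      rfl
    · have hUQ : Q ≤ U ⊔ Q := le_sup_right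
      rw [imageIn_sup _ (hUQ.trans (f1.trans hU.ge)) (le_sup_right.trans hU.ge),
        imageIn_congr (φ' := ψ) (hUQ.trans (f1.trans hU.ge)) hUQ, hi,
        imageIn_congr (φ' := χ) (le_sup_right.trans hU.ge) le_sup_right, hj]
      · exact fun x h => rfl
      · exact fun x h => f2 ⟨x, hUQ h⟩

theorem isNormal_pCore [Finite G] (F : FusionSystem p G) : F.IsNormal F.pCore :=
  SupClosed.sSup_mem (s := {Q | F.IsNormal Q}) (fun _ h _ h' => h.sup h') (Set.toFinite _)
    F.isNormal_bot subset_rfl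

theorem pCore_normalizer_base (F : FusionSystem p G) :
    (F.normalizer F.base le_rfl).pCore = F.base :=
  le_antisymm ((pCore_le_base _).trans inf_le_left)
    (F.isNormal_normalizer F.base le_rfl).le_pCore

/-! ### Centric radical subgroups -/

theorem isConj_refl {Q : Subgroup G} (hQ : Q ≤ F.base) : F.IsConj Q Q :=
  ⟨MulEquiv.refl Q, F.id_mem hQ, F.id_mem hQ⟩

theorem isConj_of_mem {P Q : Subgroup G} {e : P ≃* Q} (he : e.toMonoidHom ∈ F.Hom P Q) :
    F.IsConj P Q :=
  ⟨e, he, F.symm_mem he⟩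

theorem IsConj.eq_base [Finite G] {P : Subgroup G} (h : F.IsConj F.base P) : P = F.base := by
  obtain ⟨e, he, -⟩ := h
  exact Subgroup.eq_of_le_of_card_ge (F.le_base he).2 (Nat.card_congr e.toEquiv).le

theorem IsCentric.mem_of_commute {Q : Subgroup G} (hQ : F.IsCentric Q) {g : G}
    (hg : g ∈ F.base) (h : ∀ x ∈ Q, x * g = g * x) : g ∈ Q := by
  have hmem : g ∈ F.base ⊓ Subgroup.centralizer (Q : Set G) :=
    ⟨hg, Subgroup.mem_centralizer_iff.2 h⟩
  rw [hQ.2 Q (isConj_refl hQ.1)] at hmem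
  exact Subgroup.map_subtype_le _ hmem

/-- If every `F`-automorphism of a centric radical subgroup `E` extends to a homomorphism which
maps a given subgroup `T` of `N_S(E)` into itself, then `T ≤ E`: the image of `Aut_T(E)` in
`Out_F(E)` is a normal `p`-subgroup, hence trivial. -/
theorem le_of_isRadical {E T : Subgroup G} (hc : F.IsCentric E) (hr : F.IsRadical E)
    (hT : T ≤ F.base) (hn : T ≤ Subgroup.normalizer (E : Set G))
    (hinv : ∀ α ∈ F.aut E hc.1, ∃ (P P' : Subgroup G) (ψ : P →* P') (hEP : E ≤ P) (hTP : T ≤ P),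
      (∀ x : E, (ψ (Subgroup.inclusion hEP x) : G) = α x) ∧
        ∀ t : T, (ψ (Subgroup.inclusion hTP t) : G) ∈ T) : T ≤ E := by
  have hnormal : ((autOf T E).subgroupOf (F.aut E hc.1)).Normal := by
    constructor
    rintro β hβ α
    -- If `β = c_t` and `ψ` extends `α`, then `α β α⁻¹` is conjugation by `ψ(t)`.
    obtain ⟨t, ht, htn, hβt⟩ := mem_autOf.1 (Subgroup.mem_subgroupOf.1 hβ)
    obtain ⟨P, P', ψ, hEP, hTP, hψ, hψT⟩ := hinv α α.2
    refine Subgroup.mem_subgroupOf.2 (mem_autOf.2 ⟨_, hψT ⟨t, ht⟩, hn (hψT ⟨t, ht⟩), fun x => ?_⟩)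
    obtain ⟨y, rfl⟩ := (α : MulAut E).surjective x
    have h1 : Subgroup.inclusion hEP ((β : MulAut E) y) = Subgroup.inclusion hTP ⟨t, ht⟩ *
        Subgroup.inclusion hEP y * (Subgroup.inclusion hTP ⟨t, ht⟩)⁻¹ := Subtype.ext (hβt y)
    have h2 : ((α * β * α⁻¹ : F.aut E hc.1) : MulAut E) ((α : MulAut E) y) =
        (α : MulAut E) ((β : MulAut E) y) := by
      simp
    rw [h2, ← hψ, ← hψ, h1]
    simp
  have hTp : IsPGroup p T := F.isPGroup_base.to_le hT
  have hbot : ((autOf T E).subgroupOf (F.aut E hc.1)).map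
      (QuotientGroup.mk' (F.inn E hc.1)) = ⊥ := by
    obtain ⟨hE, hr⟩ := hr
    refine le_bot_iff.1 (hr ▸ le_sSup ⟨?_, ?_⟩)
    · exact hnormal.map _ (QuotientGroup.mk'_surjective _)
    · exact ((isPGroup_autOf hTp E).comap_of_injective _ Subtype.val_injective).map _
  intro t ht
  obtain ⟨α, hα⟩ : ∃ α : F.aut E hc.1, ∀ x : E, ((α : MulAut E) x : G) = t * x * t⁻¹ :=
    ⟨⟨E.normalizerMonoidHom ⟨t, hn ht⟩, autOf_le_aut hT hc.1
      (mem_autOf.2 ⟨t, ht, hn ht, fun x => rfl⟩)⟩, fun x => rfl⟩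
  have hinn : α ∈ F.inn E hc.1 := by
    rw [← QuotientGroup.eq_one_iff, ← Subgroup.mem_bot, ← hbot]
    exact ⟨α, Subgroup.mem_subgroupOf.2 (mem_autOf.2 ⟨t, ht, hn ht, hα⟩), rfl⟩
  obtain ⟨g, hg, hgx⟩ := mem_inn.1 hinn
  -- `t` and `g ∈ E` induce the same automorphism of `E`, so `g⁻¹ t` lies in `C_S(E) = Z(E)`.
  have hmem : g⁻¹ * t ∈ E := by
    refine hc.mem_of_commute (mul_mem (inv_mem (hc.1 hg)) (hT ht)) fun x hx => ?_
    have h := (hα ⟨x, hx⟩).symm.trans (hgx ⟨x, hx⟩)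
    have h' : t * x = g * x * g⁻¹ * t := by
      rw [← h]
      simp
    rw [mul_assoc, h']
    simp [mul_assoc]
  simpa using mul_mem hg hmem

/-- `O_p(F)` is contained in every centric radical subgroup `E`: apply `le_of_isRadical` to the
normaliser of `E` in `E O_p(F)`. -/
theorem pCore_le_of_isRadical [Finite G] [Fact p.Prime] {E : Subgroup G} (hc : F.IsCentric E)
    (hr : F.IsRadical E) : F.pCore ≤ E := by
  obtain ⟨hPb, hPn, hext⟩ := isNormal_iff.1 F.isNormal_pCore
  have hb : E ⊔ F.pCore ≤ F.base := sup_le hc.1 hPb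
  have key : (E ⊔ F.pCore) ⊓ Subgroup.normalizer (E : Set G) ≤ E := by
    refine le_of_isRadical hc hr (inf_le_left.trans hb) inf_le_right fun α hα => ?_
    obtain ⟨ψ, hψ, ⟨hE, hψα⟩, -⟩ := hext E E _ hα
    refine ⟨_, _, ψ, hE, inf_le_left, hψα, fun t => ⟨(ψ _).2, ?_⟩⟩
    have hconj : ∀ t : ↥(E ⊔ F.pCore), (t : G) ∈ Subgroup.normalizer (E : Set G) → ∀ x ∈ E,
        (ψ t : G) * x * (ψ t : G)⁻¹ ∈ E := by
      intro t ht x hx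
      obtain ⟨y, hy⟩ := α.surjective ⟨x, hx⟩
      have hy' : (t : G) * y * (t : G)⁻¹ ∈ E := (Subgroup.mem_normalizer_iff.1 ht y).1 y.2
      have h1 : Subgroup.inclusion hE ⟨_, hy'⟩ = t * Subgroup.inclusion hE y * t⁻¹ := rfl
      have h2 := hψα ⟨_, hy'⟩
      have h3 := hψα y
      rw [h1, map_mul, map_mul, map_inv] at h2
      change _ = ((α y : E) : G) at h3
      rw [hy] at h3
      change _ = x at h3
      rw [← h3]
      have h4 := (α ⟨_, hy'⟩).2
      change _ = ((α ⟨_, hy'⟩ : E) : G) at h2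
      rw [← h2] at h4
      exact h4
    refine Subgroup.mem_normalizer_iff.2 fun x => ⟨hconj _ t.2.2 x, fun hx => ?_⟩
    have := hconj (Subgroup.inclusion inf_le_left t)⁻¹ (inv_mem t.2.2) _ hx
    simpa [mul_assoc] using this
  by_contra h
  have hlt : E < E ⊔ F.pCore := left_lt_sup.2 h
  obtain ⟨x, hx, hxn, hxE⟩ := exists_mem_normalizer_notMem (F.isPGroup_base.to_le hb) hlt
  exact hxE (key ⟨hx, hxn⟩)

theorem aut_mem_normalizer {E : Subgroup G} (hE : E ≤ F.base) {α : MulAut E}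
    (hα : α ∈ F.aut E hE) : α.toMonoidHom ∈ (F.normalizer E hE).Hom E E := by
  have hb : E ≤ F.baseNormalizer E := le_inf hE Subgroup.le_normalizer
  have hEE : E ⊔ E = E := sup_idem E
  refine ⟨hα, hb, hb, (Subgroup.inclusion hEE.ge).comp
    (α.toMonoidHom.comp (Subgroup.inclusion hEE.le)),
    F.restrict_mem hα (hEE.le.trans hE) ⟨hEE.le, fun x => rfl⟩, ⟨hEE.ge, fun x => rfl⟩, ?_⟩
  ext y
  rw [mem_imageIn]
  constructor
  · rintro ⟨x, -, rfl⟩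
    exact (α _).2
  · intro hy
    refine ⟨Subgroup.inclusion hEE.ge (α.symm ⟨y, hy⟩), (α.symm ⟨y, hy⟩).2, ?_⟩
    exact congrArg Subtype.val (α.apply_symm_apply ⟨y, hy⟩)

/-- Centric radical subgroups are weakly centric-radical. -/
theorem pCore_normalizer_eq_of_isRadical [Finite G] {E : Subgroup G} (hc : F.IsCentric E)
    (hr : F.IsRadical E) : (F.normalizer E hc.1).pCore = E := by
  refine le_antisymm ?_ (F.isNormal_normalizer E hc.1).le_pCore
  obtain ⟨hPb, -, hext⟩ := isNormal_iff.1 (F.normalizer E hc.1).isNormal_pCore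
  refine le_of_isRadical hc hr (hPb.trans inf_le_left) (hPb.trans inf_le_right) fun α hα => ?_
  obtain ⟨ψ, hψ, ⟨hE, hψα⟩, hi⟩ := hext E E _ (aut_mem_normalizer hc.1 hα)
  refine ⟨_, _, ψ, hE, le_sup_right, hψα, fun t => ?_⟩
  exact (mem_iff_of_imageIn_eq hi _).2 ⟨_, t.2, rfl⟩

theorem IsEssential.isRadical [Finite G] [Fact p.Prime] {E : Subgroup G} (h : F.IsEssential E) :
    F.IsRadical E := by
  obtain ⟨-, -, hE, M, hM⟩ := h
  exact ⟨hE, hM.groupPCore_eq_bot⟩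

/-- `S` itself is not essential, because `Inn(S)` is a Sylow `p`-subgroup of `Aut_F(S)`. -/
theorem IsSaturated.not_isEssential_base [Finite G] [Fact p.Prime] (hF : F.IsSaturated) :
    ¬ F.IsEssential F.base := by
  rintro ⟨-, -, hS, M, hM⟩
  obtain ⟨Q, hQ, hfa, -⟩ := hF F.base le_rfl
  obtain rfl := hQ.eq_base
  obtain ⟨_, T, hT⟩ := hfa
  have hsurj := QuotientGroup.mk'_surjective (F.inn F.base hS)
  have hbot : (Sylow.mapSurjective hsurj T : Subgroup (F.Out F.base hS)) = ⊥ := by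
    rw [Sylow.coe_mapSurjective, hT, eq_bot_iff, Subgroup.map_le_iff_le_comap]
    intro α hα
    obtain ⟨g, hg, -, h⟩ := mem_autBase.1 (Subgroup.mem_subgroupOf.1 hα)
    exact (QuotientGroup.eq_one_iff α).2 (mem_inn.2 ⟨g, hg, h⟩)
  refine (Sylow.mapSurjective hsurj T).not_dvd_index ?_
  rw [hbot, Subgroup.index_bot]
  exact hM.2.1.trans (Subgroup.card_subgroup_dvd_card M)

/-! ### Receptive subgroups and their normalisers -/

/-- A conjugate `P` of a fully automised and receptive subgroup `Q` has an isomorphism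
`a : P → Q` in `F` which extends to `N_S(P)`: by Sylow's theorem in `Aut_F(Q)`, any isomorphism can
be corrected by an element of `Aut_F(Q)` so as to carry `Aut_S(P)` into `Aut_S(Q)`. -/
theorem IsConj.exists_extends_baseNormalizer [Finite G] [Fact p.Prime] {P Q : Subgroup G}
    (h : F.IsConj P Q) (hfa : F.IsFullyAutomised Q) (hrec : F.IsReceptive Q) :
    ∃ a : P ≃* Q, a.toMonoidHom ∈ F.Hom P Q ∧
      ∃ ψ ∈ F.Hom (F.baseNormalizer P) F.base, Extends ψ a.toMonoidHom := by
  obtain ⟨e, he, he'⟩ := h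
  obtain ⟨hQ, T, hT⟩ := hfa
  have hP := (F.le_base he).1
  have hpD : IsPGroup p (((F.autBase P).map (MulAut.congr e).toMonoidHom).subgroupOf
      (F.aut Q hQ)) :=
    ((isPGroup_autOf F.isPGroup_base P).map _).comap_of_injective _ Subtype.val_injective
  obtain ⟨T', hT'⟩ := hpD.exists_le_sylow
  obtain ⟨β, rfl⟩ := MulAction.exists_smul_eq (F.aut Q hQ) T' T
  have ha : (e.trans (β : MulAut Q)).toMonoidHom ∈ F.Hom P Q := F.comp_mem he β.2
  obtain ⟨ψ, hψ, hext⟩ := hrec.2 P _ ha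
  refine ⟨_, ha, ?_⟩
  have hle : F.baseNormalizer P ≤ F.extDomain (e.trans (β : MulAut Q)) := by
    rintro g ⟨hg, hgn⟩
    refine mem_extDomain.2 ⟨hg, hgn, ?_⟩
    have hcg : P.normalizerMonoidHom ⟨g, hgn⟩ ∈ F.autBase P :=
      mem_autBase.2 ⟨g, hg, hgn, fun x => rfl⟩
    have hδ : MulAut.congr e (P.normalizerMonoidHom ⟨g, hgn⟩) ∈ F.aut Q hQ :=
      F.comp_mem he' (F.comp_mem (autBase_le_aut hP hcg) he)
    have hmem : (⟨_, hδ⟩ : F.aut Q hQ) ∈ T' := hT' ⟨_, hcg, rfl⟩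
    have hconj : β * ⟨_, hδ⟩ * β⁻¹ ∈ ((β • T' : Sylow p _) : Subgroup (F.aut Q hQ)) := by
      rw [Sylow.coe_subgroup_smul]
      exact ⟨_, hmem, rfl⟩
    rw [hT] at hconj
    exact hconj
  have hb : F.baseNormalizer P ≤ F.base := inf_le_left
  refine ⟨ψ.comp (Subgroup.inclusion hle), F.restrict_mem hψ le_rfl ⟨hle, fun x => rfl⟩, ?_⟩
  obtain ⟨h1, h2⟩ := hext
  exact ⟨le_inf hP Subgroup.le_normalizer, h2⟩

theorem mem_baseNormalizer_of_extends {P Q : Subgroup G} {a : P ≃* Q}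
    {ψ : F.baseNormalizer P →* F.base} (h : Extends ψ a.toMonoidHom)
    (g : F.baseNormalizer P) : (ψ g : G) ∈ F.baseNormalizer Q := by
  obtain ⟨hP, hx⟩ := h
  have hconj : ∀ g : F.baseNormalizer P, ∀ y ∈ Q, (ψ g : G) * y * (ψ g : G)⁻¹ ∈ Q := by
    intro g y hy
    obtain ⟨x, hxy⟩ := a.surjective ⟨y, hy⟩
    have hgx : (g : G) * x * (g : G)⁻¹ ∈ P := (Subgroup.mem_normalizer_iff.1 g.2.2 x).1 x.2
    have h1 : Subgroup.inclusion hP ⟨_, hgx⟩ = g * Subgroup.inclusion hP x * g⁻¹ := rfl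
    have h2 := hx ⟨_, hgx⟩
    have h3 : (ψ (Subgroup.inclusion hP x) : G) = y := (hx x).trans (congrArg Subtype.val hxy)
    rw [h1, map_mul, map_mul, map_inv] at h2
    have h4 : (ψ g : G) * y * (ψ g : G)⁻¹ = a ⟨_, hgx⟩ := by
      rw [← h3]
      exact h2
    rw [h4]
    exact (a _).2
  refine ⟨(ψ g).2, Subgroup.mem_normalizer_iff.2 fun y => ⟨hconj g y, fun hy => ?_⟩⟩
  have := hconj g⁻¹ _ hy
  simpa [mul_assoc] using this

theorem IsFullyAutomised.isFullyNormalised [Finite G] [Fact p.Prime] {Q : Subgroup G}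
    (hfa : F.IsFullyAutomised Q) (hrec : F.IsReceptive Q) : F.IsFullyNormalised Q := by
  refine ⟨hrec.1, fun P hP => ?_⟩
  have hPQ : F.IsConj P Q := let ⟨e, he, he'⟩ := hP; ⟨e.symm, he', he⟩
  obtain ⟨a, ha, ψ, hψ, hext⟩ := hPQ.exists_extends_baseNormalizer hfa hrec
  refine Nat.card_le_card_of_injective
    (fun g => (⟨ψ g, mem_baseNormalizer_of_extends hext g⟩ : F.baseNormalizer Q))
    fun g g' h => F.injective hψ (Subtype.ext (Subtype.mk.inj h))

/-- For a fully automised and receptive subgroup, being centric need not be tested on its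
conjugates. -/
theorem IsFullyAutomised.isCentric [Finite G] [Fact p.Prime] {Q : Subgroup G}
    (hfa : F.IsFullyAutomised Q) (hrec : F.IsReceptive Q)
    (hC : ∀ g ∈ F.base, (∀ x ∈ Q, x * g = g * x) → g ∈ Q) : F.IsCentric Q := by
  refine ⟨hrec.1, fun P hP => ?_⟩
  have hPQ : F.IsConj P Q := let ⟨e, he, he'⟩ := hP; ⟨e.symm, he', he⟩
  obtain ⟨a, ha, ψ, hψ, hPN, hx⟩ := hPQ.exists_extends_baseNormalizer hfa hrec
  refine le_antisymm ?_ ?_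
  · rintro g ⟨hg, hgC⟩
    have hgC' := Subgroup.mem_centralizer_iff.1 hgC
    have hgn : g ∈ F.baseNormalizer P := ⟨hg, Subgroup.centralizer_le_normalizer _ hgC⟩
    have hψg : (ψ ⟨g, hgn⟩ : G) ∈ Q := by
      refine hC _ (ψ _).2 fun y hy => ?_
      obtain ⟨x, hxy⟩ := a.surjective ⟨y, hy⟩
      have h3 : (ψ (Subgroup.inclusion hPN x) : G) = y := (hx x).trans (congrArg Subtype.val hxy)
      have h1 : Subgroup.inclusion hPN x * ⟨g, hgn⟩ = ⟨g, hgn⟩ * Subgroup.inclusion hPN x :=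
        Subtype.ext (hgC' x x.2)
      have h2 := congrArg (fun z => (ψ z : G)) h1
      simp only [map_mul, Subgroup.coe_mul, h3] at h2
      exact h2
    obtain ⟨x, hxg⟩ := a.surjective ⟨_, hψg⟩
    have h3 : ψ (Subgroup.inclusion hPN x) = ψ ⟨g, hgn⟩ :=
      Subtype.ext ((hx x).trans (congrArg Subtype.val hxg))
    have h4 : (x : G) = g := congrArg Subtype.val (F.injective hψ h3)
    refine ⟨x, Subgroup.mem_center_iff.2 fun y => Subtype.ext ?_, h4⟩
    change (y : G) * x = x * y
    rw [h4]
    exact hgC' y y.2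
  · rintro _ ⟨x, hxc, rfl⟩
    refine ⟨(F.le_base ha).1 x.2, Subgroup.mem_centralizer_iff.2 fun y hy => ?_⟩
    exact congrArg Subtype.val (Subgroup.mem_center_iff.1 hxc ⟨y, hy⟩)

/-! ### Morphisms which extend to automorphisms of `S` -/

/-- `φ` is the restriction of an element of `Aut_F(S)`. -/
def ExtendsToBase (F : FusionSystem p G) {P Q : Subgroup G} (φ : P →* Q) : Prop :=
  ∃ α ∈ F.aut F.base le_rfl, Extends α.toMonoidHom φ

theorem ExtendsToBase.of_extends {P Q P' Q' : Subgroup G} {φ : P →* Q} {ψ : P' →* Q'}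
    (hψ : F.ExtendsToBase ψ) (h : Extends ψ φ) : F.ExtendsToBase φ := by
  obtain ⟨α, hα, h1, h2⟩ := hψ
  obtain ⟨h3, h4⟩ := h
  exact ⟨α, hα, h3.trans h1, fun x => (h2 _).trans (h4 x)⟩

theorem ExtendsToBase.comp {P Q R : Subgroup G} {φ : P →* Q} {ψ : Q →* R}
    (hψ : F.ExtendsToBase ψ) (hφ : F.ExtendsToBase φ) : F.ExtendsToBase (ψ.comp φ) := by
  obtain ⟨α, hα, h1, h2⟩ := hψ
  obtain ⟨β, hβ, h3, h4⟩ := hφ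
  refine ⟨α * β, mul_mem hα hβ, h3, fun x => ?_⟩
  have h5 : β (Subgroup.inclusion h3 x) = Subgroup.inclusion h1 (φ x) := Subtype.ext (h4 x)
  change (α (β (Subgroup.inclusion h3 x)) : G) = _
  rw [h5]
  exact h2 _

theorem ExtendsToBase.symm {P Q : Subgroup G} (hQ : Q ≤ F.base) {e : P ≃* Q}
    (he : F.ExtendsToBase e.toMonoidHom) : F.ExtendsToBase e.symm.toMonoidHom := by
  obtain ⟨α, hα, h1, h2⟩ := he
  refine ⟨α⁻¹, inv_mem hα, hQ, fun x => ?_⟩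
  obtain ⟨y, rfl⟩ := e.surjective x
  have h5 : Subgroup.inclusion hQ (e y) = α (Subgroup.inclusion h1 y) := Subtype.ext (h2 y).symm
  change ((α⁻¹ (Subgroup.inclusion hQ (e y)) : F.base) : G) = (e.symm (e y) : P)
  rw [h5, MulAut.inv_apply_self, e.symm_apply_apply]
  rfl

theorem extendsToBase_of_conj {P Q : Subgroup G} (hP : P ≤ F.base) {g : G} (hg : g ∈ F.base)
    {φ : P →* Q} (h : ∀ x : P, (φ x : G) = g * x * g⁻¹) : F.ExtendsToBase φ :=
  ⟨MulAut.conj ⟨g, hg⟩, F.conj_mem le_rfl le_rfl g hg _ fun _ => rfl, hP, fun x => (h x).symm⟩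

/-- The subgroup of `Aut_F(Q)` of those automorphisms which extend to `S`. -/
def extendableAut (F : FusionSystem p G) (Q : Subgroup G) (hQ : Q ≤ F.base) :
    Subgroup (F.aut Q hQ) where
  carrier := {β | F.ExtendsToBase (β : MulAut Q).toMonoidHom}
  one_mem' := extendsToBase_of_conj hQ (one_mem _) (by simp)
  mul_mem' ha hb := ha.comp hb
  inv_mem' ha := ha.symm hQ

theorem mem_extendableAut_of_conj {Q : Subgroup G} (hQ : Q ≤ F.base) {g : G}
    (hg : g ∈ F.base) {β : F.aut Q hQ} (h : ∀ x : Q, ((β : MulAut Q) x : G) = g * x * g⁻¹) :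
    β ∈ F.extendableAut Q hQ :=
  extendsToBase_of_conj hQ hg h

theorem mem_extendableAut_of_mem_extDomain [Finite G] {Q : Subgroup G}
    (hrec : F.IsReceptive Q)
    (hext : ∀ (P R : Subgroup G) (φ : P →* R), Nat.card Q < Nat.card P → φ ∈ F.Hom P R →
      F.ExtendsToBase φ)
    {β : F.aut Q hrec.1} {u : G} (hu : u ∈ F.extDomain (β : MulAut Q)) (huQ : u ∉ Q) :
    β ∈ F.extendableAut Q hrec.1 := by
  obtain ⟨ψ, hψ, hψβ⟩ := hrec.2 Q _ β.2
  have hlt : Q < F.extDomain (β : MulAut Q) :=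
    lt_of_le_of_ne hψβ.1 fun h => huQ (h.symm ▸ hu)
  exact (hext _ _ ψ (Set.ncard_lt_ncard (t := (F.extDomain (β : MulAut Q) : Set G)) hlt
    (Set.toFinite _)) hψ).of_extends hψβ

/-- If all morphisms from subgroups of larger order extend to `S` but some automorphism of `Q`
does not, then the automorphisms of `Q` which extend to `S` form a strongly `p`-embedded subgroup
in `Out_F(Q)`. -/
theorem IsFullyAutomised.isEssential [Finite G] [Fact p.Prime] {Q : Subgroup G}
    (hfa : F.IsFullyAutomised Q) (hrec : F.IsReceptive Q) (hQ : Q < F.base)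
    (hext : ∀ (P R : Subgroup G) (φ : P →* R), Nat.card Q < Nat.card P → φ ∈ F.Hom P R →
      F.ExtendsToBase φ)
    (hne : F.extendableAut Q hrec.1 ≠ ⊤) : F.IsEssential Q := by
  -- An element of `C_S(Q)` outside `Q` would lie in the extension domain of every automorphism.
  have hC : ∀ g ∈ F.base, (∀ x ∈ Q, x * g = g * x) → g ∈ Q := by
    intro g hg hgC
    by_contra hgQ
    refine hne ((Subgroup.eq_top_iff' _).2 fun β => ?_)
    have hgn : g ∈ Subgroup.normalizer (Q : Set G) :=
      Subgroup.centralizer_le_normalizer _ (Subgroup.mem_centralizer_iff.2 hgC)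
    refine mem_extendableAut_of_mem_extDomain hrec hext (mem_extDomain.2 ⟨hg, hgn, ?_⟩) hgQ
    refine mem_autBase.2 ⟨g, hg, hgn, fun x => ?_⟩
    have h1 : Q.normalizerMonoidHom ⟨g, hgn⟩ ((β : MulAut Q).symm x) = (β : MulAut Q).symm x := by
      refine Subtype.ext ?_
      change g * ((β : MulAut Q).symm x : Q) * g⁻¹ = _
      rw [← hgC _ ((β : MulAut Q).symm x).2, mul_inv_cancel_right]
    change (((β : MulAut Q) (Q.normalizerMonoidHom ⟨g, hgn⟩ ((β : MulAut Q).symm x)) : Q) : G) = _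
    rw [h1, MulEquiv.apply_symm_apply, ← hgC _ x.2, mul_inv_cancel_right]
  refine ⟨hfa.isFullyNormalised hrec, hfa.isCentric hrec hC, hrec.1, ?_⟩
  obtain ⟨_, T, hT⟩ := hfa
  have hsurj := QuotientGroup.mk'_surjective (F.inn Q hrec.1)
  have hinn : F.inn Q hrec.1 ≤ F.extendableAut Q hrec.1 := fun α hα => by
    obtain ⟨g, hg, h⟩ := mem_inn.1 hα
    exact mem_extendableAut_of_conj hrec.1 (hrec.1 hg) h
  have hTB : (T : Subgroup (F.aut Q hrec.1)) ≤ F.extendableAut Q hrec.1 := by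
    rw [hT]
    intro α hα
    obtain ⟨g, hg, -, h⟩ := mem_autBase.1 (Subgroup.mem_subgroupOf.1 hα)
    exact mem_extendableAut_of_conj hrec.1 hg h
  refine ⟨(F.extendableAut Q hrec.1).map (QuotientGroup.mk' _),
    isStronglyEmbedded_of_sylow (Sylow.mapSurjective hsurj T) ?_ ?_ ?_ ?_⟩
  · rw [Sylow.coe_mapSurjective]
    exact Subgroup.map_mono hTB
  · intro htop
    refine hne ?_
    have h1 := congrArg (Subgroup.comap (QuotientGroup.mk' (F.inn Q hrec.1))) htop
    rwa [Subgroup.comap_map_eq_self (by rwa [QuotientGroup.ker_mk']), Subgroup.comap_top] at h1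
  · intro hbot
    obtain ⟨x, hx, hxn, hxQ⟩ := exists_mem_normalizer_notMem F.isPGroup_base hQ
    have hxa : Q.normalizerMonoidHom ⟨x, hxn⟩ ∈ F.autBase Q :=
      mem_autBase.2 ⟨x, hx, hxn, fun y => rfl⟩
    have hxT : (⟨_, autBase_le_aut hrec.1 hxa⟩ : F.aut Q hrec.1) ∈ T := by
      change _ ∈ (T : Subgroup (F.aut Q hrec.1))
      rw [hT]
      exact hxa
    have hx1 : (⟨_, autBase_le_aut hrec.1 hxa⟩ : F.aut Q hrec.1) ∈ F.inn Q hrec.1 := by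
      rw [← QuotientGroup.eq_one_iff, ← Subgroup.mem_bot, ← hbot, Sylow.coe_mapSurjective]
      exact ⟨_, hxT, rfl⟩
    obtain ⟨g, hg, hgx⟩ := mem_inn.1 hx1
    refine hxQ ?_
    have hmem : g⁻¹ * x ∈ Q := by
      refine hC _ (mul_mem (inv_mem (hrec.1 hg)) hx) fun y hy => ?_
      have h : x * y * x⁻¹ = g * y * g⁻¹ := hgx ⟨y, hy⟩
      have h' : x * y = g * y * g⁻¹ * x := by
        rw [← h]
        simp
      rw [mul_assoc, h']
      simp [mul_assoc]
    simpa using mul_mem hg hmem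
  -- `t` is the class of `τ = c_s`, and `g⁻¹ t g` that of `σ = c_s'`; for a lift `β` of `g` this
  -- means `β⁻¹ τ β = c_u` with `u = s' q`, `q ∈ Q`, so that `u` is in the extension domain of `β`.
  · rintro g t ⟨τ, hτ, rfl⟩ ht1 ⟨σ, hσ, hσg⟩
    obtain ⟨β, rfl⟩ := hsurj g
    refine ⟨β, ?_, rfl⟩
    rw [hT] at hτ hσ
    obtain ⟨s, hs, hsn, hsτ⟩ := mem_autBase.1 (Subgroup.mem_subgroupOf.1 hτ)
    obtain ⟨s', hs', hsn', hsσ⟩ := mem_autBase.1 (Subgroup.mem_subgroupOf.1 hσ)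
    have hq : σ⁻¹ * (β⁻¹ * τ * β) ∈ F.inn Q hrec.1 := by
      rw [← QuotientGroup.eq]
      exact hσg
    obtain ⟨q, hqQ, hq⟩ := mem_inn.1 hq
    have hun : s' * q ∈ Subgroup.normalizer (Q : Set G) :=
      mul_mem hsn' (Subgroup.le_normalizer hqQ)
    have hu : Q.normalizerMonoidHom ⟨s' * q, hun⟩ =
        ((β⁻¹ * τ * β : F.aut Q hrec.1) : MulAut Q) := by
      ext x
      have h1 : ((β⁻¹ * τ * β : F.aut Q hrec.1) : MulAut Q) x =
          (σ : MulAut Q) (((σ⁻¹ * (β⁻¹ * τ * β) : F.aut Q hrec.1) : MulAut Q) x) := by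
        simp
      rw [h1, hsσ, hq]
      change s' * q * x * (s' * q)⁻¹ = _
      group
    have hτu : ((β : MulAut Q).symm.trans (Q.normalizerMonoidHom ⟨s' * q, hun⟩)).trans
        (β : MulAut Q) = (τ : MulAut Q) := by
      rw [hu]
      ext x
      change (((β : MulAut Q) (((β⁻¹ * τ * β : F.aut Q hrec.1) : MulAut Q)
        ((β : MulAut Q)⁻¹ x)) : Q) : G) = _
      simp
    refine mem_extendableAut_of_mem_extDomain (u := s' * q) hrec hext
      (mem_extDomain.2 ⟨mul_mem hs' (hrec.1 hqQ), hun, ?_⟩) fun huQ => ht1 ?_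
    · rw [hτu]
      exact hτ
    · refine (QuotientGroup.eq_one_iff τ).2 ?_
      have h2 : (β⁻¹ * τ * β) ∈ F.inn Q hrec.1 := by
        refine mem_inn.2 ⟨_, huQ, fun x => ?_⟩
        rw [← hu]
        rfl
      have h3 := (F.inn_normal Q hrec.1).conj_mem _ h2 β
      simpa [mul_assoc] using h3

/-- The part of Alperin's fusion theorem that is used here: morphisms from subgroups larger than
every essential subgroup are restrictions of automorphisms of `S`. -/
theorem IsSaturated.extendsToBase [Finite G] [Fact p.Prime] (hF : F.IsSaturated)
    {P R : Subgroup G} {φ : P →* R} (hφ : φ ∈ F.Hom P R)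
    (hess : ∀ E, F.IsEssential E → Nat.card E < Nat.card P) : F.ExtendsToBase φ := by
  -- Downward induction on the order of `P`.
  induction hn : Nat.card G - Nat.card P using Nat.strong_induction_on generalizing P R with
  | _ n ih =>
  have hext : ∀ (P' R' : Subgroup G) (φ' : P' →* R'), Nat.card P < Nat.card P' →
      φ' ∈ F.Hom P' R' → F.ExtendsToBase φ' := by
    intro P' R' φ' hlt hφ'
    refine ih _ ?_ hφ' (fun E hE => (hess E hE).trans hlt) rfl
    have : Nat.card P' ≤ Nat.card G := Subgroup.card_le_card_group P'
    omega
  obtain ⟨P', hP'R, e, he, -, rfl⟩ := F.factor hφ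
  suffices h : F.ExtendsToBase e.toMonoidHom from
    let ⟨α, hα, h1, h2⟩ := h
    ⟨α, hα, h1, h2⟩
  have hP := (F.le_base he).1
  have hcard : Nat.card P = Nat.card P' := Nat.card_congr e.toEquiv
  rcases hP.eq_or_lt with rfl | hlt
  · obtain rfl := (isConj_of_mem he).eq_base
    exact ⟨e, he, le_rfl, fun x => rfl⟩
  -- A morphism which extends to the normaliser of its domain is covered by the induction.
  have hstep : ∀ {A Q : Subgroup G} {a : A ≃* Q}, Nat.card A = Nat.card P →
      a.toMonoidHom ∈ F.Hom A Q →
      (∃ ψ ∈ F.Hom (F.baseNormalizer A) F.base, Extends ψ a.toMonoidHom) →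
      F.ExtendsToBase a.toMonoidHom := by
    rintro A Q a hA ha ⟨ψ, hψ, hψa⟩
    have hAb := (F.le_base ha).1
    have hAlt : A < F.base := by
      refine lt_of_le_of_ne hAb ?_
      rintro rfl
      have := Set.ncard_lt_ncard (s := (P : Set G)) (t := (F.base : Set G)) hlt (Set.toFinite _)
      exact this.ne hA.symm
    obtain ⟨x, hx, hxn, hxA⟩ := exists_mem_normalizer_notMem F.isPGroup_base hAlt
    have hlt' : A < F.baseNormalizer A :=
      lt_of_le_of_ne hψa.1 fun h => hxA (h.symm ▸ (⟨hx, hxn⟩ : x ∈ F.baseNormalizer A))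
    refine (hext _ _ ψ ?_ hψ).of_extends hψa
    rw [← hA]
    exact Set.ncard_lt_ncard (t := (F.baseNormalizer A : Set G)) hlt' (Set.toFinite _)
  obtain ⟨Q, hPQ, hfa, hrec⟩ := hF P hP
  have hP'Q : F.IsConj P' Q := by
    obtain ⟨f, hf, hf'⟩ := hPQ
    exact ⟨e.symm.trans f, F.comp_mem (F.symm_mem he) hf, F.comp_mem hf' he⟩
  obtain ⟨a, ha, hψ⟩ := hPQ.exists_extends_baseNormalizer hfa hrec
  obtain ⟨a', ha', hψ'⟩ := hP'Q.exists_extends_baseNormalizer hfa hrec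
  have hae := hstep rfl ha hψ
  have hae' := hstep hcard.symm ha' hψ'
  have hQcard : Nat.card P = Nat.card Q := Nat.card_congr a.toEquiv
  have htop : F.extendableAut Q hrec.1 = ⊤ := by
    by_contra hne
    have hQlt : Q < F.base := by
      refine lt_of_le_of_ne hrec.1 ?_
      rintro rfl
      have := Set.ncard_lt_ncard (s := (P : Set G)) (t := (F.base : Set G)) hlt (Set.toFinite _)
      exact this.ne hQcard
    exact (hess Q (hfa.isEssential hrec hQlt (hQcard ▸ hext) hne)).ne hQcard.symm
  have hβ : ((a.symm.trans e).trans a').toMonoidHom ∈ F.Hom Q Q :=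
    F.comp_mem (F.comp_mem (F.symm_mem ha) he) ha'
  have hβe : F.ExtendsToBase ((a.symm.trans e).trans a').toMonoidHom := by
    have : (⟨_, hβ⟩ : F.aut Q hrec.1) ∈ F.extendableAut Q hrec.1 := htop ▸ Subgroup.mem_top _
    exact this
  -- `e` is the automorphism `a' e a⁻¹` of `Q`, transported back along `a` and `a'`.
  have heq : e.toMonoidHom = a'.symm.toMonoidHom.comp
      (((a.symm.trans e).trans a').toMonoidHom.comp a.toMonoidHom) := by
    ext x
    simp
  rw [heq]
  exact (hae'.symm hrec.1).comp (hβe.comp hae)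

theorem mem_baseNormalizer_iff_of_aut {R : Subgroup G} (hR : R ≤ F.base)
    {α : MulAut F.base} (hαR : ∀ x : F.base, (x : G) ∈ R ↔ (α x : G) ∈ R) (x : F.base) :
    (x : G) ∈ F.baseNormalizer R ↔ (α x : G) ∈ F.baseNormalizer R := by
  have hconj : ∀ y : F.base, (x : G) * y * (x : G)⁻¹ ∈ R ↔
      (α x : G) * α y * (α x : G)⁻¹ ∈ R := by
    intro y
    refine (hαR (x * y * x⁻¹)).trans ?_
    rw [map_mul, map_mul, map_inv]
    rfl
  have hmem : ∀ z : F.base, (z : G) ∈ F.baseNormalizer R ↔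
      ∀ y : F.base, (y : G) ∈ R ↔ (z : G) * y * (z : G)⁻¹ ∈ R := by
    intro z
    refine ⟨fun hz y => Subgroup.mem_normalizer_iff.1 hz.2 y, fun h =>
      ⟨z.2, Subgroup.mem_normalizer_iff.2 fun y => ⟨fun hy => (h ⟨y, hR hy⟩).1 hy, fun hy => ?_⟩⟩⟩
    have hyb : y ∈ F.base := by
      have := F.base.mul_mem (F.base.mul_mem (F.base.inv_mem z.2) (hR hy)) z.2
      simpa [mul_assoc] using this
    exact (h ⟨y, hyb⟩).2 hy
  rw [hmem, hmem]
  constructor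
  · intro h y
    obtain ⟨y, rfl⟩ := α.surjective y
    rw [← hαR, h, hconj]
  · intro h y
    rw [hαR, h, hconj]

/-- If every morphism defined on an overgroup of `R` extends to `S`, then `N_S(R)` is normal in
`N_F(R)`. -/
theorem isNormal_baseNormalizer {R : Subgroup G} (hR : R ≤ F.base)
    (hext : ∀ (P P' : Subgroup G) (φ : P →* P'), R ≤ P → φ ∈ F.Hom P P' → F.ExtendsToBase φ) :
    (F.normalizer R hR).IsNormal (F.baseNormalizer R) := by
  refine isNormal_iff.2 ⟨le_rfl, Subgroup.le_normalizer, ?_⟩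
  rintro U V φ hφ
  obtain ⟨hφF, hU, hV, ψ, hψ, ⟨e1, e2⟩, hi⟩ := id hφ
  obtain ⟨α, hα, h1, h2⟩ := hext _ _ ψ le_sup_right hψ
  have hb : F.baseNormalizer R ≤ F.base := inf_le_left
  have hRb : R ≤ F.baseNormalizer R := le_inf hR Subgroup.le_normalizer
  have hαR : ∀ x : F.base, (x : G) ∈ R ↔ (α x : G) ∈ R := by
    intro x
    constructor
    · intro hx
      refine (mem_iff_of_imageIn_eq hi _).2 ⟨⟨x, (le_sup_right : R ≤ U ⊔ R) hx⟩, hx, ?_⟩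
      exact (h2 ⟨x, (le_sup_right : R ≤ U ⊔ R) hx⟩).symm
    · intro hx
      obtain ⟨y, hy, hyx⟩ := (mem_iff_of_imageIn_eq hi _).1 hx
      have h3 : α (Subgroup.inclusion h1 y) = α x := Subtype.ext ((h2 y).trans hyx)
      rw [← α.injective h3]
      exact hy
  have hαN := mem_baseNormalizer_iff_of_aut hR hαR
  have hUN : U ⊔ F.baseNormalizer R = F.baseNormalizer R := sup_eq_right.2 hU
  have hVN : V ⊔ F.baseNormalizer R = F.baseNormalizer R := sup_eq_right.2 hV
  let ψ' : ↥(U ⊔ F.baseNormalizer R) →* ↥(V ⊔ F.baseNormalizer R) :=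
    (F.base.subtype.comp (α.toMonoidHom.comp (Subgroup.inclusion (hUN.le.trans hb)))).codRestrict _
      fun x => hVN.ge ((hαN _).1 (hUN.le x.2))
  have hψ' : ∀ x, (ψ' x : G) = α ⟨x, hUN.le.trans hb x.2⟩ := fun x => rfl
  clear_value ψ'
  have hψ'F : ψ' ∈ F.Hom _ _ := F.restrict_mem hα (hVN.le.trans hb)
    ⟨hUN.le.trans hb, fun x => (hψ' x).symm⟩
  have hψ'R : imageIn ψ' R = R := by
    ext y
    rw [mem_imageIn]
    constructor
    · rintro ⟨x, hx, rfl⟩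
      rw [hψ']
      exact (hαR _).1 hx
    · intro hy
      obtain ⟨x, hx⟩ := α.surjective ⟨y, hR hy⟩
      have hxR : (x : G) ∈ R := by
        rw [hαR, hx]
        exact hy
      exact ⟨⟨x, hUN.ge (hRb hxR)⟩, hxR, (hψ' _).trans (congrArg Subtype.val hx)⟩
  have hUR : U ⊔ F.baseNormalizer R ⊔ R = U ⊔ F.baseNormalizer R :=
    sup_eq_left.2 (hRb.trans le_sup_right)
  have hVR : V ⊔ F.baseNormalizer R ≤ V ⊔ F.baseNormalizer R ⊔ R := le_sup_left
  obtain ⟨χ, hχ⟩ : ∃ χ : ↥(U ⊔ F.baseNormalizer R ⊔ R) →* ↥(V ⊔ F.baseNormalizer R ⊔ R),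
      ∀ x, (χ x : G) = ψ' (Subgroup.inclusion hUR.le x) :=
    ⟨(Subgroup.inclusion hVR).comp (ψ'.comp (Subgroup.inclusion hUR.le)), fun x => rfl⟩
  have hχF : χ ∈ F.Hom _ _ := F.restrict_mem hψ'F (sup_le (hVN.le.trans hb) hR)
    ⟨hUR.le, fun x => (hχ x).symm⟩
  have hχR : imageIn χ R = R := by
    have hRU : R ≤ U ⊔ F.baseNormalizer R ⊔ R := le_sup_right
    exact (imageIn_congr hRU (hRb.trans le_sup_right) fun x hx => hχ ⟨x, hRU hx⟩).trans hψ'R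
  refine ⟨ψ', ⟨hψ'F, hUN.le, hVN.le, χ, hχF, ⟨hUR.ge, fun x => hχ _⟩, hχR⟩,
    ⟨le_sup_left, fun x => ?_⟩, ?_⟩
  · exact (hψ' _).trans ((h2 (Subgroup.inclusion e1 x)).trans (e2 x))
  · ext y
    rw [mem_imageIn]
    constructor
    · rintro ⟨x, hx, rfl⟩
      rw [hψ']
      exact (hαN _).1 hx
    · intro hy
      obtain ⟨x, hx⟩ := α.surjective ⟨y, hb hy⟩
      have hxN : (x : G) ∈ F.baseNormalizer R := by
        rw [hαN, hx]
        exact hy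
      exact ⟨⟨x, hUN.ge hxN⟩, hxN, (hψ' _).trans (congrArg Subtype.val hx)⟩

/-! ### Essential subgroups and `O_p(F)` -/

theorem eq_base_of_baseNormalizer_eq [Finite G] [Fact p.Prime] {R : Subgroup G}
    (hR : R ≤ F.base) (h : F.baseNormalizer R = R) : R = F.base := by
  by_contra hne
  obtain ⟨x, hx, hxn, hxR⟩ := exists_mem_normalizer_notMem F.isPGroup_base (lt_of_le_of_ne hR hne)
  exact hxR (h ▸ (⟨hx, hxn⟩ : x ∈ F.baseNormalizer R))

theorem pCore_normalizer_eq_base {R : Subgroup G} (hR : R ≤ F.base)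
    (hext : ∀ (P P' : Subgroup G) (φ : P →* P'), R ≤ P → φ ∈ F.Hom P P' → F.ExtendsToBase φ) :
    (F.normalizer R hR).pCore = (F.normalizer R hR).base :=
  le_antisymm (pCore_le_base _) (isNormal_baseNormalizer hR hext).le_pCore

theorem IsSaturated.pCore_eq_base_of_forall_not_isEssential [Finite G] [Fact p.Prime]
    (hF : F.IsSaturated) (h : ∀ E, ¬ F.IsEssential E) : F.pCore = F.base := by
  have := pCore_normalizer_eq_base (F := F) bot_le
    fun P P' φ _ hφ => hF.extendsToBase hφ fun E hE => (h E hE).elim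
  rwa [normalizer_bot] at this

theorem IsSaturated.pCore_ne_base [Finite G] [Fact p.Prime] (hF : F.IsSaturated)
    (h : {Q | F.IsEssential Q} = {F.pCore}) : F.pCore ≠ F.base := fun heq =>
  hF.not_isEssential_base (heq ▸ (h.symm ▸ rfl : F.pCore ∈ {Q | F.IsEssential Q}))

/-- If `O_p(F)` is the only essential subgroup, then above it fusion is controlled by `Aut_F(S)`,
so that `O_p(N_F(R)) = N_S(R)` for `R > O_p(F)`. -/
theorem IsSaturated.pCore_normalizer_of_pCore_lt [Finite G] [Fact p.Prime] (hF : F.IsSaturated)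
    (h : {Q | F.IsEssential Q} = {F.pCore}) {R : Subgroup G} (hR : R ≤ F.base)
    (hlt : F.pCore < R) : (F.normalizer R hR).pCore = (F.normalizer R hR).base := by
  refine pCore_normalizer_eq_base hR fun P P' φ hRP hφ => hF.extendsToBase hφ fun E hE => ?_
  have hE' : E = F.pCore := by
    have : E ∈ {Q | F.IsEssential Q} := hE
    rwa [h] at this
  rw [hE']
  exact Set.ncard_lt_ncard (t := (P : Set G)) (hlt.trans_le hRP) (Set.toFinite _)

/-- If `S` is the only member of `F^{fcr}` above `O_p(F) ≠ S`, then `O_p(F)` is the only essential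
subgroup: essential subgroups belong to `F^{fcr}` and contain `O_p(F)`, they differ from `S`, and
there are some because otherwise `O_p(F) = S`. -/
theorem IsSaturated.setOf_isEssential_eq [Finite G] [Fact p.Prime] (hF : F.IsSaturated)
    (hne : F.pCore ≠ F.base) (h : ∀ R, F.IsParabolic R → R = F.base) :
    {Q | F.IsEssential Q} = {F.pCore} := by
  have key : ∀ E, F.IsEssential E → E = F.pCore := by
    intro E hE
    by_contra hne'
    have hlt : F.pCore < E :=
      lt_of_le_of_ne (pCore_le_of_isRadical hE.2.1 hE.isRadical) (Ne.symm hne')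
    have hEb := h E ⟨hE.1, hE.2.1, hE.isRadical, hlt⟩
    subst hEb
    exact hF.not_isEssential_base hE
  refine Set.Subset.antisymm key ?_
  rintro _ rfl
  by_contra hno
  exact hne (hF.pCore_eq_base_of_forall_not_isEssential fun E hE => hno (key E hE ▸ hE))

theorem IsParabolic.pCore_normalizer_eq [Finite G] {R : Subgroup G} (hR : F.IsParabolic R) :
    (F.normalizer R hR.fullyNormalised.1).pCore = R :=
  pCore_normalizer_eq_of_isRadical hR.centric hR.radical

/-! ### The weakly local rank -/

theorem IsWeaklyCentricRadicalChain.length_le_weaklyLocalRank [Finite G]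
    {σ : LTSeries (Subgroup G)} (hσ : F.IsWeaklyCentricRadicalChain σ) :
    σ.length ≤ F.weaklyLocalRank := by
  have := Fintype.ofFinite (Subgroup G)
  refine le_csSup ⟨Fintype.card (Subgroup G), ?_⟩ ⟨σ, hσ, rfl⟩
  rintro _ ⟨τ, -, rfl⟩
  exact τ.length_lt_card.le

theorem exists_chain_length_eq_weaklyLocalRank [Finite G] (h : F.weaklyLocalRank ≠ 0) :
    ∃ σ : LTSeries (Subgroup G), F.IsWeaklyCentricRadicalChain σ ∧
      σ.length = F.weaklyLocalRank := by
  have := Fintype.ofFinite (Subgroup G)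
  refine Nat.sSup_mem (s := {n | ∃ σ : LTSeries (Subgroup G),
    F.IsWeaklyCentricRadicalChain σ ∧ σ.length = n}) ?_ ⟨Fintype.card (Subgroup G), ?_⟩
  · by_contra hempty
    refine h ?_
    rw [weaklyLocalRank, Set.not_nonempty_iff_eq_empty.1 hempty, csSup_empty]
    rfl
  · rintro _ ⟨τ, -, rfl⟩
    exact τ.length_lt_card.le

/-- The chain `O_p(F) < S`. -/
theorem one_le_weaklyLocalRank [Finite G] (hne : F.pCore ≠ F.base) : 1 ≤ F.weaklyLocalRank := by
  have hlt : F.pCore < F.base := lt_of_le_of_ne F.pCore_le_base hne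
  let σ : LTSeries (Subgroup G) :=
    { length := 1
      toFun := ![F.pCore, F.base]
      step := by
        intro i
        fin_cases i
        exact hlt }
  refine IsWeaklyCentricRadicalChain.length_le_weaklyLocalRank (F := F) (σ := σ)
    ⟨F.isNormal_pCore, fun _ => hlt, ![F, F.normalizer F.base le_rfl], rfl, fun i => ?_⟩
  fin_cases i
  exact ⟨⟨le_rfl, F.pCore_normalizer_base⟩, le_rfl, rfl⟩

/-- The chain `O_p(F) < R < N_S(R)`. -/
theorem two_le_weaklyLocalRank [Finite G] [Fact p.Prime] {R : Subgroup G}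
    (hR : F.IsWeaklyCentricRadical R) (hlt : F.pCore < R) (hne : R ≠ F.base) :
    2 ≤ F.weaklyLocalRank := by
  obtain ⟨hRb, hR⟩ := hR
  have hlt' : R < F.baseNormalizer R :=
    lt_of_le_of_ne (le_inf hRb Subgroup.le_normalizer)
      fun h => hne (eq_base_of_baseNormalizer_eq hRb h.symm)
  let σ : LTSeries (Subgroup G) :=
    { length := 2
      toFun := ![F.pCore, R, F.baseNormalizer R]
      step := by
        intro i
        fin_cases i
        exacts [hlt, hlt'] }
  refine IsWeaklyCentricRadicalChain.length_le_weaklyLocalRank (F := F) (σ := σ)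
    ⟨F.isNormal_pCore, fun _ => hlt, ![F, F.normalizer R hRb,
      (F.normalizer R hRb).normalizer (F.baseNormalizer R) le_rfl], rfl, fun i => ?_⟩
  fin_cases i
  · exact ⟨⟨hRb, hR⟩, hRb, rfl⟩
  · exact ⟨⟨le_rfl, (F.normalizer R hRb).pCore_normalizer_base⟩, le_rfl, rfl⟩

theorem IsWeaklyCentricRadicalChain.pCore_ne_base {σ : LTSeries (Subgroup G)}
    (hσ : F.IsWeaklyCentricRadicalChain σ) (h : 0 < σ.length) : F.pCore ≠ F.base := by
  obtain ⟨-, h1, E, hE0, hE⟩ := hσ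
  obtain ⟨-, hle, -⟩ := hE ⟨0, h⟩
  rw [show (Fin.castSucc ⟨0, h⟩ : Fin (σ.length + 1)) = 0 from rfl, hE0] at hle
  exact ((h1 h).trans_le hle).ne

/-- If `O_p(N_F(R)) = N_S(R)` for all `R > O_p(F)`, then no chain can be continued
beyond its second term. -/
theorem IsWeaklyCentricRadicalChain.length_le_one {σ : LTSeries (Subgroup G)}
    (hσ : F.IsWeaklyCentricRadicalChain σ)
    (h : ∀ (R : Subgroup G) (hR : R ≤ F.base), F.pCore < R →
      (F.normalizer R hR).pCore = (F.normalizer R hR).base) : σ.length ≤ 1 := by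
  by_contra! hlen
  have h0 : 0 < σ.length := Nat.zero_lt_one.trans hlen
  obtain ⟨-, h1, E, hE0, hE⟩ := hσ
  obtain ⟨⟨hR, hcore⟩, hR', hE1⟩ := hE ⟨0, h0⟩
  obtain ⟨-, hle, -⟩ := hE ⟨1, hlen⟩
  have hlt : σ (Fin.succ ⟨0, h0⟩) < σ (Fin.succ ⟨1, hlen⟩) := σ.step ⟨1, hlen⟩
  have hE1' : (E (Fin.castSucc ⟨1, hlen⟩)).base = σ (Fin.succ ⟨0, h0⟩) := by
    rw [show (Fin.castSucc ⟨1, hlen⟩ : Fin (σ.length + 1)) = Fin.succ ⟨0, h0⟩ from rfl, hE1]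
    refine Eq.trans ?_ hcore
    have hF : E (Fin.castSucc ⟨0, h0⟩) = F := hE0
    generalize E (Fin.castSucc ⟨0, h0⟩) = F' at *
    subst hF
    exact (h _ hR (h1 h0)).symm
  exact hlt.not_ge (hE1' ▸ hle)

theorem IsSaturated.weaklyLocalRank_eq_one_iff [Finite G] [Fact p.Prime] (hF : F.IsSaturated) :
    F.weaklyLocalRank = 1 ↔ {Q | F.IsEssential Q} = {F.pCore} := by
  constructor
  · intro h
    obtain ⟨σ, hσ, hlen⟩ := exists_chain_length_eq_weaklyLocalRank (F := F) (by omega)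
    refine hF.setOf_isEssential_eq (hσ.pCore_ne_base (by omega)) fun R hR => ?_
    by_contra hne
    have := two_le_weaklyLocalRank ⟨hR.fullyNormalised.1, hR.pCore_normalizer_eq⟩ hR.pCore_lt hne
    omega
  · intro h
    have h1 := one_le_weaklyLocalRank (hF.pCore_ne_base h)
    obtain ⟨σ, hσ, hlen⟩ := exists_chain_length_eq_weaklyLocalRank (F := F) (by omega)
    have := hσ.length_le_one fun R hR hlt => hF.pCore_normalizer_of_pCore_lt h hR hlt
    omega

/-! ### The local rank -/

theorem localRank_eq_zero_iff [Finite G] : F.localRank = 0 ↔ F.pCore = F.base := by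
  rw [localRank]
  split_ifs with h
  · simp [h]
  · simp [h]

theorem IsSaturated.localRank_eq_one_iff [Finite G] [Fact p.Prime] (hF : F.IsSaturated) :
    F.localRank = 1 ↔ {Q | F.IsEssential Q} = {F.pCore} := by
  constructor
  · intro h
    have hne : F.pCore ≠ F.base := fun h0 => by
      have := localRank_eq_zero_iff.2 h0
      omega
    refine hF.setOf_isEssential_eq hne fun R hR => ?_
    rw [localRank, if_neg hne] at h
    have h0 : (F.normalizer R hR.fullyNormalised.1).localRank = 0 := by
      have := le_ciSup (f := fun R : {R : Subgroup G // F.IsParabolic R} =>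
        (F.normalizer R.1 R.2.fullyNormalised.1).localRank) (Set.finite_range _).bddAbove ⟨R, hR⟩
      simp only at this
      omega
    rw [localRank_eq_zero_iff, hR.pCore_normalizer_eq] at h0
    exact eq_base_of_baseNormalizer_eq hR.fullyNormalised.1 h0.symm
  · intro h
    rw [localRank, if_neg (hF.pCore_ne_base h)]
    have h0 : ∀ R : {R : Subgroup G // F.IsParabolic R},
        (F.normalizer R.1 R.2.fullyNormalised.1).localRank = 0 := fun R =>
      localRank_eq_zero_iff.2 (hF.pCore_normalizer_of_pCore_lt h _ R.2.pCore_lt)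
    simp_rw [h0]
    cases isEmpty_or_nonempty {R : Subgroup G // F.IsParabolic R} <;> simp

end FusionSystem

theorem mainTheorem6 {p : ℕ} [Fact p.Prime] {G : Type*} [Group G] [Finite G]
    (F : FusionSystem p G) (hF : F.IsSaturated) :
    (F.weaklyLocalRank = 1 ↔ {Q | F.IsEssential Q} = {F.pCore}) ∧
      (F.localRank = 1 ↔ {Q | F.IsEssential Q} = {F.pCore}) :=
  ⟨hF.weaklyLocalRank_eq_one_iff, hF.localRank_eq_one_iff⟩
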